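/- **Setting.** Let $(E_n,\mathscr E_n)_{n\ge 0}$ be measurable spaces with countably generated $\sigma$-fields and let $d\in\mathbb N$. Let $\eta_0$ be a probability measure on $E_0$. For every $n\ge 0$ and $\xi\in\mathbb R^d$ let $M_{n+1,\xi}$ be a Markov kernel from $E_n$ to $E_{n+1}$ and $G_{n,\xi}:E_n\to(0,\infty)$ a strictly positive weight function, both jointly measurable in $(\xi,x)$, and let $\xi_{n+1}:E_n\to\mathbb R^d$ be a measurable summary statistic. Put $Q_{n+1,\xi}(x,dy)=G_{n,\xi}(x)\,M_{n+1,\xi}(x,dy)$. *Limiting measures.* With $M_n= M_{n,\eta_{n-1}(\xi_n)}$ and $G_n= G_{n,\eta_n(\xi_{n+1})}$, let $\gamma_n(\phi)=\mathbb E\big[\prod_{p=0}^{n-1}G_p(X_p)\,\phi(X_n)\big]$ and $\eta_n=\gamma_n/\gamma_n(1)$, where $(X_n)$ is the non-homogeneous Markov chain with $X_0\sim\eta_0$ and transitions $M_n$; equivalently $\gamma_0=\eta_0$ and $\gamma_{n+1}=\gamma_nQ_{n+1}$ with $Q_{n+1}= Q_{n+1,\eta_n(\xi_{n+1})}$. *Adaptive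 SMC algorithm.* For $N\ge1$, the particles $x_0^1,\dots,x_0^N$ are i.i.d. with law $\eta_0$; given the particles up to time $n$, with empirical measure $\eta_n^N=\frac1N\sum_{i=1}^N\delta_{x_n^i}$, the particles $x_{n+1}^1,\dots,x_{n+1}^N$ are i.i.d. with law $\eta_n^N(Q_{n+1,\zeta})(dy)/\eta_n^N(G_{n,\zeta})$ at the empirical parameter $\zeta=\eta_n^N(\xi_{n+1})$. Put $G_{n,N}= G_{n,\eta_n^N(\xi_{n+1})}$ and $\gamma_n^N(\phi)=\big\{\prod_{p=0}^{n-1}\eta_p^N(G_{p,N})\big\}\,\eta_n^N(\phi)$. **Assumptions.** A function $f(x,\xi)$ is called continuous at $\xi=\xi^*$ uniformly in $x$ if $\sup\{|f(x,\xi)-f(x,\xi^*)| : x,\ |\xi-\xi^*|<\delta\}\to0$ as $\delta\to0^+$. For each $n\ge 0$ let $\mathrm{Dom}(\xi_{n+1})\subset\mathbb R^d$ be a convex set containing the range of $\xi_{n+1}$. (A1) For each $n\ge0$, the function $(x,\xi)\mapsto G_{n,\xi}(x)$ is bounded on $E_n\times\mathbb R^d$ and continuous at $\xi=\eta_n(\xi_{n+1})$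 uniformly in $x\in E_n$; the statistic $\xi_{n+1}$ is bounded; and for every bounded measurable $\phi:E_{n+1}\to\mathbb R$ the function $(x,\xi)\mapsto Q_{n+1,\xi}\phi(x)$ is bounded on $E_n\times\mathbb R^d$ and continuous at $\xi=\eta_n(\xi_{n+1})$ uniformly in $x\in E_n$. (A2) For each $n\ge0$ and every bounded measurable $\phi:E_{n+1}\to\mathbb R$, the derivative $\partial_\xi Q_{n+1,\xi}\phi(x)$ exists for all $(x,\xi)\in E_n\times\mathrm{Dom}(\xi_{n+1})$, is bounded there, and, as a function on $E_n\times\mathrm{Dom}(\xi_{n+1})$, is continuous at $\xi=\eta_n(\xi_{n+1})$ uniformly in $x\in E_n$. **Theorem.** Assume (A1)–(A2). Let $n\ge0$, $r\ge1$ and let $\phi_n:E_n\to\mathbb R^r$ be bounded and measurable. Then, as $N\to\infty$, $\sqrt N\,[\gamma_n^N-\gamma_n](\phi_n)$ converges weakly to a centred Gaussian distribution on $\mathbb R^r$ with covariance matrix $$\sum_{p=0}^n\gamma_p(1)^2\,\Sigma_{\eta_p}(\mathscr L_{p,n}\phi_n),\qquad \Sigma_\mu(\phi)=\int[\phi-\mu(\phi)][\phi-\mu(\phi)]^{\top}\,d\mu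 ,$$ where, for bounded measurable $\phi:E_p\to\mathbb R^r$ and $p\ge 1$, the function $\mathscr L_p\phi:E_{p-1}\to\mathbb R^r$ is $$\mathscr L_p\phi=\eta_{p-1}\big[\partial_\xi Q_{p,\xi}\phi\big|_{\xi=\eta_{p-1}(\xi_p)}\big]\,\big(\xi_p-\eta_{p-1}(\xi_p)\big)+Q_p\phi ,$$ and $\mathscr L_{p,n}=\mathscr L_{p+1}\circ\cdots\circ\mathscr L_n$, $\mathscr L_{n,n}=\mathrm{Id}$. -/

import Mathlib

open MeasureTheory ProbabilityTheory Filter Topology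
open scoped ENNReal

noncomputable section

/-- `f : X × Y → Z` is continuous at `y₀`, uniformly over `x ∈ X`; here the second variable is
restricted to a set `S` of parameters. -/
def UniformlyContinuousAtParam {X Y Z : Type*} [PseudoMetricSpace Y] [PseudoMetricSpace Z]
    (f : X → Y → Z) (S : Set Y) (y₀ : Y) : Prop :=
  ∀ ε > 0, ∃ δ > 0, ∀ x : X, ∀ y ∈ S, dist y y₀ < δ → dist (f x y) (f x y₀) < ε

/-- Bounded measurable functions. -/
def IsBoundedMeasurable {X V : Type*} [MeasurableSpace X] [NormedAddCommGroup V]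
    [MeasurableSpace V] (φ : X → V) : Prop :=
  Measurable φ ∧ ∃ C : ℝ, ∀ x, ‖φ x‖ ≤ C

/-- The covariance matrix `Σ_μ(φ) = ∫ (φ - μ(φ)) ⊗ (φ - μ(φ)) dμ`. -/
def covMat {X : Type*} [MeasurableSpace X] {r : ℕ} (μ : Measure X)
    (φ : X → EuclideanSpace ℝ (Fin r)) : Matrix (Fin r) (Fin r) ℝ :=
  Matrix.of fun i j =>
    ∫ x, (φ x - ∫ y, φ y ∂μ) i * (φ x - ∫ y, φ y ∂μ) j ∂μ

/-- The empirical measure `N⁻¹ ∑ δ_{xᵢ}` of `N` particles. -/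
def empirical {X : Type*} [MeasurableSpace X] {N : ℕ} (x : Fin N → X) : Measure X :=
  (N : ℝ≥0∞)⁻¹ • ∑ i, Measure.dirac (x i)

lemma lintegral_empirical {X : Type*} [MeasurableSpace X] {N : ℕ} (x : Fin N → X)
    {f : X → ℝ≥0∞} (hf : Measurable f) :
    ∫⁻ z, f z ∂(empirical x) = (N : ℝ≥0∞)⁻¹ * ∑ i, f (x i) := by
  simp [empirical, lintegral_finsetSum_measure, lintegral_dirac' _ hf]

lemma isProbabilityMeasure_empirical {X : Type*} [MeasurableSpace X] {N : ℕ} (hN : N ≠ 0)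
    (x : Fin N → X) : IsProbabilityMeasure (empirical x) := by
  refine ⟨?_⟩
  have h := lintegral_empirical x (f := fun _ => 1) measurable_const
  simp only [lintegral_const, one_mul, Finset.sum_const, Finset.card_univ, Fintype.card_fin,
    nsmul_eq_mul, mul_one] at h
  rw [h, ENNReal.inv_mul_cancel (by exact_mod_cast hN) (ENNReal.natCast_ne_top N)]

lemma integral_empirical {X V : Type*} [MeasurableSpace X] [NormedAddCommGroup V]
    [NormedSpace ℝ V] [CompleteSpace V] {N : ℕ} (x : Fin N → X)
    {f : X → V} (hf : StronglyMeasurable f) :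
    ∫ z, f z ∂(empirical x) = (N : ℝ)⁻¹ • ∑ i, f (x i) := by
  rw [empirical, integral_smul_measure, integral_finsetSum_measure]
  · simp [integral_dirac' _ _ hf]
  · intro i _
    exact integrable_dirac' hf (by simp)

/-- The ingredients of the adaptive algorithm on the state spaces `E 0, E 1, …`, with summary
statistics in `ℝ^d`.

* `init` is the initial distribution `η₀`;
* `M n (ξ, x)` is the Markov transition `M_{n+1,ξ}(x, ·)` from `E n` to `E (n+1)`;
* `G n ξ x` is the strictly positive potential `G_{n,ξ}(x)` on `E n`;
* `stat n` is the summary statistic `ξ_{n+1} : E n → ℝ^d`. -/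
structure AdaptiveSMC (E : ℕ → Type*) [∀ n, MeasurableSpace (E n)] (d : ℕ) where
  init : Measure (E 0)
  isProbabilityMeasure_init : IsProbabilityMeasure init
  M : ∀ n, Kernel (EuclideanSpace ℝ (Fin d) × E n) (E (n + 1))
  isMarkovKernel_M : ∀ n, IsMarkovKernel (M n)
  G : ∀ n, EuclideanSpace ℝ (Fin d) → E n → ℝ
  measurable_G : ∀ n, Measurable fun z : EuclideanSpace ℝ (Fin d) × E n => G n z.1 z.2
  G_pos : ∀ n ξ x, 0 < G n ξ x
  stat : ∀ n, E n → EuclideanSpace ℝ (Fin d)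
  measurable_stat : ∀ n, Measurable (stat n)

namespace AdaptiveSMC

variable {E : ℕ → Type*} [∀ n, MeasurableSpace (E n)] {d : ℕ} (S : AdaptiveSMC E d)

attribute [instance] isProbabilityMeasure_init isMarkovKernel_M

lemma measurable_ofReal_G (n : ℕ) (ξ : EuclideanSpace ℝ (Fin d)) :
    Measurable fun x => ENNReal.ofReal (S.G n ξ x) :=
  ((S.measurable_G n).comp measurable_prodMk_left).ennreal_ofReal

/-- The non-negative kernel `Q_{n+1,ξ}(x, dy) = G_{n,ξ}(x) M_{n+1,ξ}(x, dy)`. -/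
def Q (n : ℕ) (ξ : EuclideanSpace ℝ (Fin d)) : Kernel (E n) (E (n + 1)) where
  toFun x := ENNReal.ofReal (S.G n ξ x) • S.M n (ξ, x)
  measurable' := by
    refine Measure.measurable_of_measurable_coe _ fun s hs => ?_
    simp only [Measure.smul_apply, smul_eq_mul]
    exact (S.measurable_ofReal_G n ξ).mul
      (((S.M n).measurable_coe hs).comp measurable_prodMk_left)

lemma Q_apply (n : ℕ) (ξ : EuclideanSpace ℝ (Fin d)) (x : E n) :
    S.Q n ξ x = ENNReal.ofReal (S.G n ξ x) • S.M n (ξ, x) := rfl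

/-! ### The limiting measures -/

/-- The unnormalised measures `γ_n`, through `γ_0 = η_0` and `γ_{n+1} = γ_n Q_{n+1,ξ}` at
`ξ = η_n(ξ_{n+1})`, where `η_n = γ_n / γ_n(1)`. That this is the Feynman-Kac measure
`φ ↦ 𝔼[∏_{p<n} G_p(X_p) φ(X_n)]` is proved in `lintegral_gamma`. -/
def gamma : ∀ n, Measure (E n)
  | 0 => S.init
  | n + 1 => (gamma n).bind
      (S.Q n (∫ x, S.stat n x ∂((gamma n Set.univ)⁻¹ • gamma n)))

/-- The normalised measures `η_n = γ_n / γ_n(1)`. -/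
def eta (n : ℕ) : Measure (E n) := (S.gamma n Set.univ)⁻¹ • S.gamma n

/-- The limiting parameter `η_n(ξ_{n+1})`. -/
def param (n : ℕ) : EuclideanSpace ℝ (Fin d) := ∫ x, S.stat n x ∂(S.eta n)

lemma gamma_zero : S.gamma 0 = S.init := rfl

lemma gamma_succ (n : ℕ) : S.gamma (n + 1) = (S.gamma n).bind (S.Q n (S.param n)) := rfl

/-- The transition `M_{n+1} = M_{n+1, η_n(ξ_{n+1})}` of the limiting Markov chain, as a kernel
from the past of the chain. -/
def chainKernel (n : ℕ) : Kernel (Π i : Finset.Iic n, E i) (E (n + 1)) :=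
  (S.M n).comap (fun x => (S.param n, x ⟨n, Finset.mem_Iic.2 le_rfl⟩)) (by fun_prop)

instance (n : ℕ) : IsMarkovKernel (S.chainKernel n) := by
  unfold chainKernel; infer_instance

/-- The law of the non-homogeneous Markov chain `(X_n)` with `X_0 ∼ η_0` and transitions
`M_{n+1, η_n(ξ_{n+1})}`. -/
def chainLaw : Measure (Π n, E n) := Kernel.trajMeasure S.init S.chainKernel

instance : IsProbabilityMeasure S.chainLaw := by
  unfold chainLaw; infer_instance

/-- `γ_n(f) = 𝔼[∏_{p<n} G_p(X_p) f(X_n)]` with `G_p = G_{p, η_p(ξ_{p+1})}`. -/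
theorem lintegral_gamma (n : ℕ) (f : E n → ℝ≥0∞) (hf : Measurable f) :
    ∫⁻ x, f x ∂(S.gamma n) =
      ∫⁻ w, (∏ p ∈ Finset.range n, ENNReal.ofReal (S.G p (S.param p) (w p))) * f (w n)
        ∂S.chainLaw := by
  induction n with
  | zero =>
    have h0 : S.chainLaw.map (fun w => w 0) = S.init := by
      have hk : S.chainLaw.map (Preorder.frestrictLe (π := E) 0) =
          S.init.map (MeasurableEquiv.piUnique (fun i : Finset.Iic 0 => E i)).symm := by
        rw [chainLaw, Kernel.trajMeasure, Measure.map_comp _ _ (by fun_prop),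
          Kernel.traj_map_frestrictLe, Kernel.partialTraj_self, Measure.id_comp]
        rfl
      have he : (fun w : Π n, E n => w 0) =
          (fun w : Π i : Finset.Iic 0, E i => w ⟨0, Finset.mem_Iic.2 le_rfl⟩) ∘
            Preorder.frestrictLe (π := E) 0 := rfl
      rw [he, ← Measure.map_map (measurable_pi_apply _) (Preorder.measurable_frestrictLe 0), hk]
      refine (Measure.map_map (measurable_pi_apply _) (MeasurableEquiv.measurable _)).trans ?_
      exact Measure.map_id
    simp only [Finset.range_zero, Finset.prod_empty, one_mul]
    rw [gamma_zero, ← h0, lintegral_map hf (measurable_pi_apply 0)]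
  | succ n ih =>
    have hG := fun p => S.measurable_ofReal_G p (S.param p)
    have hM : Measurable fun x => ∫⁻ y, f y ∂(S.M n (S.param n, x)) :=
      (hf.lintegral_kernel (κ := S.M n)).comp measurable_prodMk_left
    have hQ : ∀ x, ∫⁻ y, f y ∂(S.Q n (S.param n) x) =
        ENNReal.ofReal (S.G n (S.param n) x) * ∫⁻ y, f y ∂(S.M n (S.param n, x)) := by
      intro x
      rw [Q_apply, lintegral_smul_measure, smul_eq_mul]
    let F : (Π i : Finset.Iic n, E i) → ℝ≥0∞ := fun u =>
      ∏ p : Finset.Iic n, ENNReal.ofReal (S.G p (S.param p) (u p))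
    have hF : Measurable F :=
      Finset.measurable_prod _ fun p _ => (hG p).comp (measurable_pi_apply p)
    have hFw : ∀ w : Π n, E n, F (Preorder.frestrictLe n w) =
        ∏ p ∈ Finset.range (n + 1), ENNReal.ofReal (S.G p (S.param p) (w p)) := by
      intro w
      have : Finset.range (n + 1) = Finset.Iic n := by ext; simp
      rw [this, ← Finset.prod_coe_sort]
      rfl
    have hFf : Measurable fun z : (Π i : Finset.Iic n, E i) × E (n + 1) => F z.1 * f z.2 :=
      (hF.comp measurable_fst).mul (hf.comp measurable_snd)
    have hmap := Kernel.map_frestrictLe_trajMeasure_compProd_eq_map_trajMeasure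
      (μ₀ := S.init) (κ := S.chainKernel) (a := n)
    have hrhs : ∫⁻ w, (∏ p ∈ Finset.range (n + 1),
          ENNReal.ofReal (S.G p (S.param p) (w p))) * f (w (n + 1)) ∂S.chainLaw =
        ∫⁻ w, F (Preorder.frestrictLe n w) *
          ∫⁻ y, f y ∂(S.M n (S.param n, w n)) ∂S.chainLaw := by
      have h1 : ∫⁻ w, (∏ p ∈ Finset.range (n + 1),
          ENNReal.ofReal (S.G p (S.param p) (w p))) * f (w (n + 1)) ∂S.chainLaw =
          ∫⁻ z, F z.1 * f z.2 ∂(S.chainLaw.map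
            (fun x => (Preorder.frestrictLe (π := E) n x, x (n + 1)))) := by
        rw [lintegral_map hFf (by fun_prop)]
        simp_rw [hFw]
      rw [h1, chainLaw, ← hmap, Measure.lintegral_compProd hFf, lintegral_map _ (by fun_prop)]
      · refine lintegral_congr fun w => ?_
        have hk : S.chainKernel n (Preorder.frestrictLe n w) = S.M n (S.param n, w n) := rfl
        rw [hk]
        exact lintegral_const_mul (F (Preorder.frestrictLe n w)) hf
      · exact hFf.lintegral_kernel_prod_right'
    rw [gamma_succ, Measure.lintegral_bind (Kernel.aemeasurable _) hf.aemeasurable, hrhs]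
    simp_rw [hQ]
    refine (ih _ ((hG n).mul hM)).trans ?_
    refine lintegral_congr fun w => ?_
    rw [hFw, Finset.prod_range_succ, mul_assoc]
    rfl

/-! ### The practical algorithm -/

/-- `Φ_{n+1,N}(μ) = μ(Q_{n+1,ξ}) / μ(G_{n,ξ})` at `ξ = μ(ξ_{n+1})`, evaluated below at the
empirical measure `μ = η_n^N`. -/
def Phi (n : ℕ) (μ : Measure (E n)) : Measure (E (n + 1)) :=
  (∫⁻ x, ENNReal.ofReal (S.G n (∫ z, S.stat n z ∂μ) x) ∂μ)⁻¹ •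
    μ.bind (S.Q n (∫ z, S.stat n z ∂μ))

lemma measurable_mean_stat (N n : ℕ) :
    Measurable fun x : Fin N → E n => ∫ z, S.stat n z ∂(empirical x) := by
  have h := fun x : Fin N → E n =>
    integral_empirical x (S.measurable_stat n).stronglyMeasurable
  simp_rw [h]
  have := S.measurable_stat n
  fun_prop

lemma Phi_empirical_apply {N n : ℕ} (x : Fin N → E n) {s : Set (E (n + 1))}
    (hs : MeasurableSet s) :
    S.Phi n (empirical x) s =
      ((N : ℝ≥0∞)⁻¹ * ∑ i, ENNReal.ofReal (S.G n (∫ z, S.stat n z ∂(empirical x)) (x i)))⁻¹ *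
      ((N : ℝ≥0∞)⁻¹ * ∑ i, ENNReal.ofReal (S.G n (∫ z, S.stat n z ∂(empirical x)) (x i)) *
        S.M n (∫ z, S.stat n z ∂(empirical x), x i) s) := by
  rw [Phi, Measure.smul_apply, smul_eq_mul, lintegral_empirical x (S.measurable_ofReal_G n _),
    Measure.bind_apply hs (Kernel.aemeasurable _),
    lintegral_empirical x ((S.Q n _).measurable_coe hs)]
  simp [Q_apply]

lemma isProbabilityMeasure_Phi {N n : ℕ} (hN : N ≠ 0) (x : Fin N → E n) :
    IsProbabilityMeasure (S.Phi n (empirical x)) := by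
  refine ⟨?_⟩
  rw [S.Phi_empirical_apply x MeasurableSet.univ]
  simp only [measure_univ, mul_one]
  have : Nonempty (Fin N) := ⟨⟨0, Nat.pos_of_ne_zero hN⟩⟩
  refine ENNReal.inv_mul_cancel ?_ ?_
  · refine mul_ne_zero (by simp) ?_
    intro h
    have := (Finset.sum_eq_zero_iff.1 h) ⟨0, Nat.pos_of_ne_zero hN⟩ (Finset.mem_univ _)
    exact absurd (ENNReal.ofReal_eq_zero.1 this) (not_le.2 (S.G_pos _ _ _))
  · refine ENNReal.mul_ne_top (by simpa using hN) ?_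
    exact ENNReal.sum_ne_top.2 fun i _ => ENNReal.ofReal_ne_top

lemma isProbabilityMeasure_pi_Phi {N n : ℕ} (x : Fin N → E n) :
    IsProbabilityMeasure (Measure.pi fun _ : Fin N => S.Phi n (empirical x)) := by
  rcases eq_or_ne N 0 with rfl | hN
  · exact ⟨by rw [Measure.pi_of_empty]; simp⟩
  · have := S.isProbabilityMeasure_Phi hN x
    infer_instance

/-- The transition of the particle system: given the `N` particles `x` at time `n`, the `N`
particles at time `n + 1` are independent with common law `Φ_{n+1,N}(η_n^N)`. -/
def particleKernel (N n : ℕ) : Kernel (Fin N → E n) (Fin N → E (n + 1)) where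
  toFun x := Measure.pi fun _ : Fin N => S.Phi n (empirical x)
  measurable' := by
    have := fun x : Fin N → E n => S.isProbabilityMeasure_pi_Phi x
    refine Measurable.measure_of_isPiSystem_of_isProbabilityMeasure
      (S := Set.pi Set.univ '' Set.pi Set.univ fun _ : Fin N => {s | MeasurableSet s})
      generateFrom_pi.symm isPiSystem_pi ?_
    rintro _ ⟨t, ht, rfl⟩
    replace ht : ∀ i, MeasurableSet (t i) := fun i => ht i (Set.mem_univ _)
    rcases eq_or_ne N 0 with rfl | hN
    · exact Subsingleton.measurable
    have := fun x : Fin N → E n => S.isProbabilityMeasure_Phi hN x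
    simp_rw [Measure.pi_pi]
    refine Finset.measurable_prod _ fun i _ => ?_
    simp_rw [S.Phi_empirical_apply _ (ht i)]
    have hm : ∀ j, Measurable fun x : Fin N → E n =>
        ((∫ z, S.stat n z ∂(empirical x), x j) : EuclideanSpace ℝ (Fin d) × E n) :=
      fun j => (S.measurable_mean_stat N n).prodMk (measurable_pi_apply j)
    have hG : ∀ j, Measurable fun x : Fin N → E n =>
        ENNReal.ofReal (S.G n (∫ z, S.stat n z ∂(empirical x)) (x j)) :=
      fun j => ((S.measurable_G n).comp (hm j)).ennreal_ofReal
    have hM : ∀ j, Measurable fun x : Fin N → E n =>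
        S.M n (∫ z, S.stat n z ∂(empirical x), x j) (t i) :=
      fun j => ((S.M n).measurable_coe (ht i)).comp (hm j)
    fun_prop

instance (N n : ℕ) : IsMarkovKernel (S.particleKernel N n) :=
  ⟨fun x => S.isProbabilityMeasure_pi_Phi x⟩

/-- The joint law of the particles `x_p^i`, `i < N`, `p ≥ 0`: the initial particles are
independent with law `η_0`, and `particleKernel` gives the law of each generation given the
previous ones. -/
def particleLaw (N : ℕ) : Measure (Π n, Fin N → E n) :=
  Kernel.trajMeasure (X := fun n => Fin N → E n) (Measure.pi fun _ : Fin N => S.init)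
    fun n => (S.particleKernel N n).comap
      (fun x : (Π i : Finset.Iic n, Fin N → E i) => x ⟨n, Finset.mem_Iic.2 le_rfl⟩)
      (measurable_pi_apply _)

instance (N : ℕ) : IsProbabilityMeasure (S.particleLaw N) := by
  unfold particleLaw; infer_instance

/-- The particle approximation
`γ_n^N(φ) = (∏_{p<n} η_p^N(G_{p,N})) η_n^N(φ)`, with `G_{p,N} = G_{p, η_p^N(ξ_{p+1})}`, as a
function of the particles. -/
def gammaN {V : Type*} [NormedAddCommGroup V] [NormedSpace ℝ V] {N : ℕ} (n : ℕ) (φ : E n → V)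
    (x : Π p, Fin N → E p) : V :=
  (∏ p ∈ Finset.range n,
    ∫ z, S.G p (∫ y, S.stat p y ∂(empirical (x p))) z ∂(empirical (x p))) •
    ∫ z, φ z ∂(empirical (x n))

/-! ### Assumptions -/

section Operators

variable {V : Type*} [NormedAddCommGroup V] [NormedSpace ℝ V]

/-- `Q_{n+1,ξ} φ (x) = ∫ φ(y) Q_{n+1,ξ}(x, dy)`. -/
def Qop (n : ℕ) (ξ : EuclideanSpace ℝ (Fin d)) (φ : E (n + 1) → V) (x : E n) : V :=
  ∫ y, φ y ∂(S.Q n ξ x)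

/-- The derivative `∂_ξ Q_{n+1,ξ} φ (x)`, a linear map on `ℝ^d`. -/
def dQ (n : ℕ) (ξ : EuclideanSpace ℝ (Fin d)) (φ : E (n + 1) → V) (x : E n) :
    EuclideanSpace ℝ (Fin d) →L[ℝ] V :=
  fderiv ℝ (fun ζ => S.Qop n ζ φ x) ξ

/-- The operator
`𝓛_{n+1} φ = η_n[∂_ξ Q_{n+1} φ] (ξ_{n+1} - η_n(ξ_{n+1})) + Q_{n+1} φ`, with `Q_{n+1}` and
`∂_ξ Q_{n+1}` taken at `ξ = η_n(ξ_{n+1})`. -/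
def L (n : ℕ) (φ : E (n + 1) → V) (x : E n) : V :=
  (∫ z, S.dQ n (S.param n) φ z ∂(S.eta n)) (S.stat n x - S.param n)
    + S.Qop n (S.param n) φ x

/-- `𝓛_{p,n} = 𝓛_{p+1} ∘ ⋯ ∘ 𝓛_n`, with `𝓛_{n,n} = Id`. -/
def Lsemi {p n : ℕ} (hpn : p ≤ n) (φ : E n → V) : E p → V :=
  Nat.decreasingInduction (motive := fun k _ => E k → V) (fun k _ f => S.L k f) φ hpn

lemma Lsemi_self (n : ℕ) (φ : E n → V) : S.Lsemi le_rfl φ = φ :=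
  Nat.decreasingInduction_self _ _

lemma Lsemi_step {p n : ℕ} (hpn : p < n) (φ : E n → V) :
    S.Lsemi hpn.le φ = S.L p (S.Lsemi (Nat.succ_le_of_lt hpn) φ) :=
  Nat.decreasingInduction_succ_left _ _ _ _

end Operators

/-- First assumption: for every `n`, the potentials `(x, ξ) ↦ G_{n,ξ}(x)`, the statistics and,
for each bounded measurable `φ`, the maps `(x, ξ) ↦ Q_{n+1,ξ} φ (x)` are bounded; the potentials
and these maps are continuous at `ξ = η_n(ξ_{n+1})` uniformly in `x`. -/
def A1 : Prop :=
  ∀ n,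
    (∃ C : ℝ, ∀ x ξ, |S.G n ξ x| ≤ C) ∧
    UniformlyContinuousAtParam (fun x ξ => S.G n ξ x) Set.univ (S.param n) ∧
    (∃ C : ℝ, ∀ x, ‖S.stat n x‖ ≤ C) ∧
    ∀ φ : E (n + 1) → ℝ, IsBoundedMeasurable φ →
      (∃ C : ℝ, ∀ x ξ, |S.Qop n ξ φ x| ≤ C) ∧
      UniformlyContinuousAtParam (fun x ξ => S.Qop n ξ φ x) Set.univ (S.param n)

/-- Second assumption, relative to sets `Dom n` (in the theorem: convex and containing the range
of `ξ_{n+1}`): for every `n` and bounded measurable `φ`, the derivative `∂_ξ Q_{n+1,ξ} φ (x)`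
exists on `E n × Dom n`, is bounded there, and is continuous at `ξ = η_n(ξ_{n+1})` uniformly in
`x`. -/
def A2 (Dom : ℕ → Set (EuclideanSpace ℝ (Fin d))) : Prop :=
  ∀ n, ∀ φ : E (n + 1) → ℝ, IsBoundedMeasurable φ →
    (∀ x, ∀ ξ ∈ Dom n, DifferentiableAt ℝ (fun ζ => S.Qop n ζ φ x) ξ) ∧
    (∃ C : ℝ, ∀ x, ∀ ξ ∈ Dom n, ‖S.dQ n ξ φ x‖ ≤ C) ∧
    UniformlyContinuousAtParam (fun x ξ => S.dQ n ξ φ x) (Dom n) (S.param n)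

/-- The asymptotic covariance `∑_{p=0}^n γ_p(1)² Σ_{η_p}(𝓛_{p,n} φ)`. -/
def asympCov {r : ℕ} (n : ℕ) (φ : E n → EuclideanSpace ℝ (Fin r)) :
    Matrix (Fin r) (Fin r) ℝ :=
  ∑ p : Fin (n + 1), ((S.gamma p).real Set.univ) ^ 2 • covMat (S.eta p) (S.Lsemi p.is_le φ)

end AdaptiveSMC

end

/-! The operator `L n` is built so that one time step of the error can be undone. Its affine
correction integrates to zero under `eta n`, so `gamma n` applied to `L n f` equals `gamma (n + 1)`
applied to `f` (`integral_gamma_L`). Hence (`gammaN_succ_sub`) the error of `gammaN` at time `n + 1`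
on `f` is the error at time `n` on `L n f`, plus a linearisation error, plus a sampling error.

The linearisation error is negligible at scale `1 / √N` (`tendsto_linErr`). It consists of a
first-order Taylor remainder in the parameter, which is `o` of a parameter error of size `1 / √N`,
and of the fluctuation of the averaged derivative times that same parameter error, a product of two
quantities of size `1 / √N`. These sizes are measured in mean square and come from an earlier
induction on time, run for all bounded test functions at once (`isRootN_gammaErr`).

Given the first generations, the sampling error is a frozen weight times a centred mean of
independent bounded variables. Its conditional characteristic function is close to a Gaussian one
with variance `condVar` (`tendsto_integral_cexp_sampErr`), and `condVar` converges in mean to the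
constant `γ_{n+1}(1)² Var_{η_{n+1}}(f)` (`tendsto_condVar`). The limiting characteristic functions
therefore multiply from one step to the next, and the variances add
(`tendsto_integral_cexp_gammaErr`).

Vector-valued test functions are reduced to scalar ones by pairing with a fixed vector, since `L`
commutes with linear functionals (`L_clm_comp`); Lévy's continuity theorem concludes. -/

/-! ### Barycentres in convex sets. -/

/-- The barycentre of a probability measure carried by a convex subset of a finite-dimensional
space belongs to this subset, which need not be closed. -/
theorem Convex.integral_mem_of_finiteDimensional {Ω : Type*} [MeasurableSpace Ω] {μ : Measure Ω}
    [IsProbabilityMeasure μ] {V : Type*} [NormedAddCommGroup V] [NormedSpace ℝ V]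
    [FiniteDimensional ℝ V] {s : Set V} (hs : Convex ℝ s) {f : Ω → V} (hf : Integrable f μ)
    (hfs : ∀ᵐ x ∂μ, f x ∈ s) : ∫ x, f x ∂μ ∈ s := by
  -- Induction on the dimension: a barycentre outside `s` forces the measure onto a hyperplane
  -- through it.
  induction h : Module.finrank ℝ V using Nat.strong_induction_on generalizing V with
  | _ k ih =>
  by_contra hm
  set m := ∫ x, f x ∂μ with hm_def
  obtain ⟨x₀, hx₀⟩ := hfs.exists
  have hgint : ∀ g : StrongDual ℝ V, ∫ x, g (f x) ∂μ = g m := fun g => g.integral_comp_comm hf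
  -- A weak separation suffices. If `s` has empty interior it lies in a proper affine subspace, and
  -- a functional constant on `s` will do.
  obtain ⟨g, hg0, hg⟩ : ∃ g : StrongDual ℝ V, g ≠ 0 ∧ ∀ a ∈ s, g a ≤ g m := by
    by_cases hint : (interior s).Nonempty
    · exact geometric_hahn_banach_of_nonempty_interior_point hs
        (fun hmem => hm (interior_subset hmem)) hint
    · have hdir : vectorSpan ℝ s < ⊤ := by
        refine lt_top_iff_ne_top.2 fun htop => hint ?_
        rw [hs.interior_nonempty_iff_affineSpan_eq_top]
        exact (AffineSubspace.affineSpan_eq_top_iff_vectorSpan_eq_top_of_nonempty ℝ V V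
          ⟨_, hx₀⟩).2 htop
      obtain ⟨g, hg0, hg⟩ := Submodule.exists_le_ker_of_lt_top _ hdir
      have hgs : ∀ a ∈ s, g a = g (f x₀) := fun a ha => by
        have := hg (vsub_mem_vectorSpan ℝ ha hx₀)
        rwa [LinearMap.mem_ker, vsub_eq_sub, map_sub, sub_eq_zero] at this
      refine ⟨LinearMap.toContinuousLinearMap g, by simpa using hg0, fun a ha => ?_⟩
      have h1 : ∫ x, LinearMap.toContinuousLinearMap g (f x) ∂μ = g (f x₀) := by
        rw [integral_congr_ae (g := fun _ => g (f x₀)), integral_const]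
        · simp
        · filter_upwards [hfs] with x hx using hgs _ hx
      rw [← hgint, h1]
      exact (hgs a ha).le
  -- The nonnegative function `g m - g ∘ f` has integral zero.
  have hgf : ∀ᵐ x ∂μ, g (f x) = g m := by
    have hint : Integrable (fun x => g m - g (f x)) μ :=
      (integrable_const _).sub (g.integrable_comp hf)
    have h0 : ∫ x, (g m - g (f x)) ∂μ = 0 := by
      rw [integral_sub (integrable_const _) (g.integrable_comp hf), hgint]
      simp
    have hnn : 0 ≤ᵐ[μ] fun x => g m - g (f x) := by
      filter_upwards [hfs] with x hx using sub_nonneg.2 (hg _ hx)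
    filter_upwards [(integral_eq_zero_iff_of_nonneg_ae hnn hint).1 h0] with x hx
    exact (sub_eq_zero.1 hx).symm
  let W : Submodule ℝ V := LinearMap.ker (g : V →ₗ[ℝ] ℝ)
  have hW : Module.finrank ℝ W < k := by
    rw [← h]
    refine Submodule.finrank_lt (fun htop => hg0 ?_)
    ext v
    exact LinearMap.mem_ker.1 (htop ▸ Submodule.mem_top : v ∈ W)
  -- The projection makes `f - m` a function with values in `W` everywhere; it changes `f - m` only
  -- on a null set.
  obtain ⟨P, hP⟩ := LinearMap.exists_leftInverse_of_injective W.subtype W.ker_subtype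
  have hPW : ∀ v (hv : v ∈ W), P v = ⟨v, hv⟩ := fun v hv =>
    LinearMap.congr_fun hP ⟨v, hv⟩
  let P' : V →L[ℝ] W := LinearMap.toContinuousLinearMap P
  have hfm : Integrable (fun x => f x - m) μ := hf.sub (integrable_const _)
  have key := ih _ hW (s := {w : W | (w : V) + m ∈ s}) (fun a ha b hb p q hp hq hpq => by
      have := hs ha hb hp hq hpq
      have e : p • ((a : V) + m) + q • ((b : V) + m) = ((p • a + q • b : W) : V) + m := by
        have : m = p • m + q • m := by rw [← add_smul, hpq, one_smul]
        push_cast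
        conv_rhs => rw [this]
        simp only [smul_add]
        abel
      rwa [e] at this) (f := fun x => P' (f x - m)) (P'.integrable_comp hfm) (by
      filter_upwards [hfs, hgf] with x hx hgx
      have hmem : f x - m ∈ W := by
        change g (f x - m) = 0
        rw [map_sub, hgx, sub_self]
      change ((P (f x - m) : W) : V) + m ∈ s
      rw [hPW _ hmem]
      simpa using hx) rfl
  rw [P'.integral_comp_comm hfm, integral_sub hf (integrable_const _)] at key
  simp only [integral_const, probReal_univ, one_smul, ← hm_def, sub_self, map_zero] at key
  exact hm (by simpa using key)

/-! ### Expansion of characteristic functions. -/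

/-- Telescoping: the factors are exchanged one at a time, each at cost at most `‖a - b‖`. This
passes from one particle to `N` independent ones. -/
theorem norm_pow_sub_pow_le_of_norm_le_one {a b : ℂ} (ha : ‖a‖ ≤ 1) (hb : ‖b‖ ≤ 1) (n : ℕ) :
    ‖a ^ n - b ^ n‖ ≤ n * ‖a - b‖ := by
  induction n with
  | zero => simp
  | succ n ih =>
    have e : a ^ (n + 1) - b ^ (n + 1) = (a ^ n - b ^ n) * a + b ^ n * (a - b) := by ring
    rw [e]
    refine (norm_add_le _ _).trans ?_
    rw [norm_mul, norm_mul, norm_pow]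
    have h1 : ‖a ^ n - b ^ n‖ * ‖a‖ ≤ n * ‖a - b‖ :=
      (mul_le_of_le_one_right (norm_nonneg _) ha).trans ih
    have h2 : ‖b‖ ^ n * ‖a - b‖ ≤ ‖a - b‖ :=
      mul_le_of_le_one_left (norm_nonneg _) (pow_le_one₀ (norm_nonneg _) hb)
    push_cast
    linarith

theorem norm_cexp_mul_I_sub_le {u : ℝ} (hu : |u| ≤ 1) :
    ‖Complex.exp (u * Complex.I) - (1 + u * Complex.I - u ^ 2 / 2)‖ ≤ |u| ^ 3 := by
  have hn : ‖(u : ℂ) * Complex.I‖ = |u| := by simp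
  -- At order three the constant is `4 / (3! * 3) = 2 / 9`, relaxed to `1`.
  have h := Complex.exp_bound (x := u * Complex.I) (by rwa [hn]) (n := 3) (by norm_num)
  rw [hn] at h
  have e : ∑ m ∈ Finset.range 3, ((u : ℂ) * Complex.I) ^ m / (m.factorial : ℂ) =
      1 + u * Complex.I - u ^ 2 / 2 := by
    simp [Finset.sum_range_succ, mul_pow]
    ring
  rw [e] at h
  refine h.trans ?_
  have : (0 : ℝ) ≤ |u| ^ 3 := by positivity
  norm_num [Nat.factorial]
  linarith

/-- Second-order expansion of the characteristic function of a centred bounded variable. -/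
theorem norm_integral_cexp_sub_le {X : Type*} [MeasurableSpace X] {μ : Measure X}
    [IsProbabilityMeasure μ] {f : X → ℝ} (hf : Measurable f) {K : ℝ} (hK : ∀ x, |f x| ≤ K)
    (h0 : ∫ x, f x ∂μ = 0) {s : ℝ} (hs : |s| * K ≤ 1) :
    ‖∫ x, Complex.exp ((s * f x : ℝ) * Complex.I) ∂μ -
      Complex.exp ((-(s ^ 2 * (∫ x, f x ^ 2 ∂μ) / 2) : ℝ))‖ ≤ 2 * (|s| * K) ^ 3 := by
  have hK0 : 0 ≤ K := by
    obtain ⟨x⟩ := μ.nonempty_of_neZero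
    exact (abs_nonneg _).trans (hK x)
  have hsf : ∀ x, |s * f x| ≤ |s| * K := fun x => by
    rw [abs_mul]; exact mul_le_mul_of_nonneg_left (hK x) (abs_nonneg _)
  have if1 : Integrable f μ := Integrable.of_bound hf.aestronglyMeasurable K (ae_of_all _ hK)
  have if2 : Integrable (fun x => f x ^ 2) μ :=
    Integrable.of_bound (hf.pow_const 2).aestronglyMeasurable (K ^ 2) (ae_of_all _ fun x => by
      rw [Real.norm_eq_abs, abs_pow]; exact pow_le_pow_left₀ (abs_nonneg _) (hK x) 2)
  have ie : Integrable (fun x => Complex.exp ((s * f x : ℝ) * Complex.I)) μ :=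
    Integrable.of_bound (by fun_prop) 1 (ae_of_all _ fun x => by
      rw [Complex.norm_exp_ofReal_mul_I])
  set v := s ^ 2 * (∫ x, f x ^ 2 ∂μ) / 2 with hv
  have it : Integrable (fun x => (1 + (s * f x : ℝ) * Complex.I - (s * f x : ℝ) ^ 2 / 2 : ℂ)) μ := by
    have h1 : Integrable (fun x => ((s * f x : ℝ) : ℂ)) μ := (if1.const_mul s).ofReal
    have h2 : Integrable (fun x => ((s ^ 2 * f x ^ 2 : ℝ) : ℂ)) μ := (if2.const_mul (s ^ 2)).ofReal
    refine (((integrable_const 1).add (h1.mul_const Complex.I)).sub (h2.div_const 2)).congr ?_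
    refine ae_of_all _ fun x => ?_
    simp [mul_pow]
  -- The first-order term disappears because `f` is centred.
  have e1 : ∫ x, (1 + (s * f x : ℝ) * Complex.I - (s * f x : ℝ) ^ 2 / 2 : ℂ) ∂μ =
      ((1 - v : ℝ) : ℂ) := by
    have h1 : Integrable (fun x => ((s * f x : ℝ) : ℂ) * Complex.I) μ :=
      (if1.const_mul s).ofReal.mul_const _
    have h2 : Integrable (fun x => ((s ^ 2 * f x ^ 2 / 2 : ℝ) : ℂ)) μ :=
      ((if2.const_mul (s ^ 2)).div_const 2).ofReal
    have : (fun x => (1 + (s * f x : ℝ) * Complex.I - (s * f x : ℝ) ^ 2 / 2 : ℂ)) =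
        fun x => (1 + (s * f x : ℝ) * Complex.I) - ((s ^ 2 * f x ^ 2 / 2 : ℝ) : ℂ) := by
      funext x; push_cast; ring
    have h3 : Integrable (fun x => 1 + ((s * f x : ℝ) : ℂ) * Complex.I) μ :=
      (integrable_const 1).add h1
    rw [this, integral_sub h3 h2, integral_add (integrable_const 1) h1, integral_mul_const, integral_complex_ofReal,
      integral_complex_ofReal, integral_const_mul, h0, integral_div, integral_const_mul]
    simp [hv]
  have hB : ‖∫ x, Complex.exp ((s * f x : ℝ) * Complex.I) ∂μ - ((1 - v : ℝ) : ℂ)‖ ≤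
      (|s| * K) ^ 3 := by
    rw [← e1, ← integral_sub ie it]
    refine (norm_integral_le_of_norm_le_const (C := (|s| * K) ^ 3) (ae_of_all _ fun x => ?_)).trans
      (by simp)
    exact (norm_cexp_mul_I_sub_le ((hsf x).trans hs)).trans
      (pow_le_pow_left₀ (abs_nonneg _) (hsf x) 3)
  have hv0 : 0 ≤ v := by
    have : 0 ≤ ∫ x, f x ^ 2 ∂μ := integral_nonneg fun x => sq_nonneg _
    positivity
  have hvK : v ≤ (|s| * K) ^ 2 / 2 := by
    have : ∫ x, f x ^ 2 ∂μ ≤ K ^ 2 := by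
      have := integral_mono if2 (integrable_const (K ^ 2)) fun x => by
        rw [← sq_abs]; exact pow_le_pow_left₀ (abs_nonneg _) (hK x) 2
      simpa using this
    rw [mul_pow, sq_abs, hv]
    have := mul_le_mul_of_nonneg_left this (sq_nonneg s)
    linarith
  have hsK : 0 ≤ |s| * K := by positivity
  have hv1 : v ≤ 1 := hvK.trans (by nlinarith)
  -- The error `v ^ 2` is of order four in `|s| * K`, hence at most cubic as `|s| * K ≤ 1`.
  have hE : ‖((1 - v : ℝ) : ℂ) - Complex.exp ((-v : ℝ))‖ ≤ (|s| * K) ^ 3 := by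
    rw [← Complex.ofReal_exp, ← Complex.ofReal_sub, Complex.norm_real, norm_sub_rev]
    have := Real.norm_exp_sub_one_sub_id_le (x := -v) (by
      rw [Real.norm_eq_abs, abs_neg, abs_of_nonneg hv0]; exact hv1)
    have e : Real.exp (-v) - (1 - v) = Real.exp (-v) - 1 - -v := by ring
    rw [e]
    refine this.trans ?_
    rw [Real.norm_eq_abs, abs_neg, abs_of_nonneg hv0]
    calc v ^ 2 ≤ ((|s| * K) ^ 2 / 2) ^ 2 := pow_le_pow_left₀ hv0 hvK 2
      _ = (|s| * K) ^ 3 * ((|s| * K) / 4) := by ring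
      _ ≤ (|s| * K) ^ 3 := mul_le_of_le_one_right (by positivity) (by linarith)
  calc _ ≤ _ := norm_sub_le_norm_sub_add_norm_sub _ ((1 - v : ℝ) : ℂ) _
    _ ≤ _ := add_le_add hB hE
    _ = _ := by ring

/-! ### Empirical means of bounded functions. -/

theorem integrable_of_isBoundedMeasurable {X V : Type*} [MeasurableSpace X]
    [NormedAddCommGroup V] [MeasurableSpace V] [BorelSpace V] [SecondCountableTopology V]
    {φ : X → V} (hφ : IsBoundedMeasurable φ) (μ : Measure X) [IsFiniteMeasure μ] :
    Integrable φ μ := by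
  obtain ⟨hm, C, hC⟩ := hφ
  exact Integrable.of_bound hm.aestronglyMeasurable C (ae_of_all _ hC)

theorem abs_integral_le_of_abs_le {X : Type*} [MeasurableSpace X] {f : X → ℝ} {K : ℝ}
    (hK : ∀ x, |f x| ≤ K) (μ : Measure X) [IsProbabilityMeasure μ] : |∫ x, f x ∂μ| ≤ K := by
  have := norm_integral_le_of_norm_le_const (μ := μ) (f := f) (C := K) (ae_of_all _ hK)
  simpa using this

theorem measurable_integral_empirical {X : Type*} [MeasurableSpace X] {f : X → ℝ}
    (hf : Measurable f) (N : ℕ) :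
    Measurable fun x : Fin N → X => ∫ z, f z ∂(empirical x) := by
  simp_rw [fun x : Fin N → X => integral_empirical x hf.stronglyMeasurable, smul_eq_mul]
  fun_prop

/-- Mean square error of the empirical mean of a bounded function. -/
theorem integral_sq_empirical_sub_le {X : Type*} [MeasurableSpace X] {μ : Measure X}
    [IsProbabilityMeasure μ] {f : X → ℝ} (hf : Measurable f) {K : ℝ} (hK : ∀ x, |f x| ≤ K)
    {N : ℕ} (hN : N ≠ 0) :
    ∫ y : Fin N → X, (∫ z, f z ∂(empirical y) - ∫ z, f z ∂μ) ^ 2 ∂(Measure.pi fun _ => μ) ≤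
      K ^ 2 / N := by
  have hN0 : (N : ℝ) ≠ 0 := by exact_mod_cast hN
  have hfi : Integrable f μ := integrable_of_isBoundedMeasurable ⟨hf, K, hK⟩ μ
  have hL : MemLp f 2 μ := MemLp.of_bound hf.aestronglyMeasurable K (ae_of_all _ hK)
  set ν : Measure (Fin N → X) := Measure.pi fun _ => μ
  have hi : ∀ i : Fin N, Integrable (fun y : Fin N → X => f (y i)) ν := fun i =>
    (measurePreserving_eval (fun _ : Fin N => μ) i).integrable_comp_of_integrable hfi
  have hmean : ∀ i : Fin N, ∫ y : Fin N → X, f (y i) ∂ν = ∫ z, f z ∂μ := fun i => by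
    have := (measurePreserving_eval (fun _ : Fin N => μ) i).map_eq
    conv_rhs => rw [← this]
    exact (integral_map (measurable_pi_apply i).aemeasurable
      hf.aestronglyMeasurable).symm
  -- Independence: the variance of the sum is `N` times that of one term.
  have hv := variance_sum_pi (μ := fun _ : Fin N => μ) (X := fun _ => f) (fun _ => hL)
  have hS : ∫ y, (∑ i : Fin N, fun ω : Fin N → X => f (ω i)) y ∂ν = N * ∫ z, f z ∂μ := by
    simp_rw [Finset.sum_apply]
    rw [integral_finsetSum _ fun i _ => hi i]
    simp [hmean]
  rw [variance_eq_integral (Finset.aemeasurable_sum _ fun i _ => (hi i).aemeasurable), hS] at hv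
  have e : ∀ y : Fin N → X, (∫ z, f z ∂(empirical y) - ∫ z, f z ∂μ) ^ 2 =
      ((N : ℝ)⁻¹) ^ 2 * ((∑ i : Fin N, fun ω : Fin N → X => f (ω i)) y - N * ∫ z, f z ∂μ) ^ 2 := by
    intro y
    rw [integral_empirical y hf.stronglyMeasurable, Finset.sum_apply, smul_eq_mul]
    field_simp
  simp_rw [e]
  rw [integral_const_mul, hv]
  have hvar : Var[f; μ] ≤ K ^ 2 := by
    refine (variance_le_expectation_sq hf.aestronglyMeasurable).trans ?_
    have := abs_integral_le_of_abs_le (f := f ^ 2) (K := K ^ 2) (fun x => by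
      rw [Pi.pow_apply, abs_pow]; exact pow_le_pow_left₀ (abs_nonneg _) (hK x) 2) μ
    exact (le_abs_self _).trans this
  simp only [Finset.sum_const, Finset.card_univ, Fintype.card_fin, nsmul_eq_mul]
  have : ((N : ℝ)⁻¹) ^ 2 * (N * Var[f; μ]) = Var[f; μ] / N := by field_simp
  rw [this]
  gcongr

/-- Characteristic function of the rescaled empirical mean of a bounded function. -/
theorem norm_integral_cexp_empirical_sub_le {X : Type*} [MeasurableSpace X] {μ : Measure X}
    [IsProbabilityMeasure μ] {f : X → ℝ} (hf : Measurable f) {K : ℝ} (hK : ∀ x, |f x| ≤ K)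
    {N : ℕ} {w : ℝ} (hN : N ≠ 0) (hw : |w| * (2 * K) ≤ √N) :
    ‖∫ y : Fin N → X, Complex.exp
        ((√N * (w * (∫ z, f z ∂(empirical y) - ∫ z, f z ∂μ)) : ℝ) * Complex.I)
          ∂(Measure.pi fun _ => μ) -
      Complex.exp ((-(w ^ 2 * (∫ z, f z ^ 2 ∂μ - (∫ z, f z ∂μ) ^ 2) / 2) : ℝ))‖ ≤
      2 * (|w| * (2 * K)) ^ 3 / √N := by
  have hNpos : (0 : ℝ) < N := by exact_mod_cast Nat.pos_of_ne_zero hN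
  have hsN : 0 < √(N : ℝ) := Real.sqrt_pos.2 hNpos
  have hNN : √(N : ℝ) * √N = N := Real.mul_self_sqrt hNpos.le
  set m := ∫ z, f z ∂μ with hm
  -- `s` is the frequency seen by a single particle. The factor `w` leaves room for the weight of
  -- the particle system, which is constant once the past is fixed.
  set s := w / √N with hs
  have hmK : |m| ≤ K := abs_integral_le_of_abs_le hK μ
  have hfi : Integrable f μ := integrable_of_isBoundedMeasurable ⟨hf, K, hK⟩ μ
  have hf2i : Integrable (fun z => f z ^ 2) μ :=
    integrable_of_isBoundedMeasurable ⟨hf.pow_const 2, K ^ 2, fun x => by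
      rw [Real.norm_eq_abs, abs_pow]; exact pow_le_pow_left₀ (abs_nonneg _) (hK x) 2⟩ μ
  have hgK : ∀ x, |f x - m| ≤ 2 * K := fun x => by
    have := abs_sub (f x) m
    linarith [hK x]
  have hg0 : ∫ x, (f x - m) ∂μ = 0 := by
    rw [integral_sub hfi (integrable_const _)]; simp [hm]
  have hg2 : ∫ x, (f x - m) ^ 2 ∂μ = ∫ z, f z ^ 2 ∂μ - m ^ 2 := by
    have : ∀ x, (f x - m) ^ 2 = f x ^ 2 - (2 * m * f x - m ^ 2) := fun x => by ring
    have h3 : Integrable (fun x => 2 * m * f x - m ^ 2) μ :=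
      (hfi.const_mul _).sub (integrable_const _)
    simp_rw [this]
    rw [integral_sub hf2i h3, integral_sub (hfi.const_mul _) (integrable_const _), integral_const_mul]
    simp only [integral_const, probReal_univ, one_smul, ← hm]
    ring
  have hsK : |s| * (2 * K) = |w| * (2 * K) / √N := by
    rw [hs, abs_div, abs_of_pos hsN]; ring
  have hs1 : |s| * (2 * K) ≤ 1 := by
    rw [hsK]; exact (div_le_one hsN).2 hw
  have key := norm_integral_cexp_sub_le (hf.sub_const m) hgK hg0 hs1
  set a := ∫ x, Complex.exp ((s * (f x - m) : ℝ) * Complex.I) ∂μ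
  set v := ∫ z, f z ^ 2 ∂μ - m ^ 2 with hv
  rw [hg2] at key
  have hv0 : 0 ≤ v := by
    rw [← hg2]; exact integral_nonneg fun x => sq_nonneg _
  have e1 : ∀ y : Fin N → X, Complex.exp
      ((√N * (w * (∫ z, f z ∂(empirical y) - m)) : ℝ) * Complex.I) =
      ∏ i, Complex.exp ((s * (f (y i) - m) : ℝ) * Complex.I) := by
    intro y
    rw [← Complex.exp_sum, integral_empirical y hf.stronglyMeasurable, ← Finset.sum_mul,
      ← Complex.ofReal_sum, ← Finset.mul_sum, Finset.sum_sub_distrib]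
    congr 3
    simp only [Finset.sum_const, Finset.card_univ, Fintype.card_fin, nsmul_eq_mul, smul_eq_mul, hs]
    field_simp
    rw [sq, hNN]
    field_simp
  simp_rw [e1]
  rw [integral_fintype_prod_eq_pow (fun x => Complex.exp ((s * (f x - m) : ℝ) * Complex.I)),
    Fintype.card_fin]
  -- The Gaussian factor is an `N`-th power too, so the bases can be compared.
  have e2 : Complex.exp ((-(w ^ 2 * v / 2) : ℝ)) =
      Complex.exp ((-(s ^ 2 * v / 2) : ℝ)) ^ N := by
    rw [← Complex.exp_nat_mul]
    congr 1
    rw [← Complex.ofReal_natCast, ← Complex.ofReal_mul, hs, div_pow, Real.sq_sqrt hNpos.le]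
    congr 1
    field_simp
  rw [e2]
  have ha : ‖a‖ ≤ 1 := by
    refine (norm_integral_le_of_norm_le_const (C := 1) (ae_of_all _ fun x => ?_)).trans (by simp)
    rw [Complex.norm_exp_ofReal_mul_I]
  have hb : ‖Complex.exp ((-(s ^ 2 * v / 2) : ℝ))‖ ≤ 1 := by
    rw [Complex.norm_exp_ofReal]
    refine Real.exp_le_one_iff.2 (neg_nonpos.2 ?_)
    positivity
  refine (norm_pow_sub_pow_le_of_norm_le_one ha hb N).trans ?_
  refine (mul_le_mul_of_nonneg_left key hNpos.le).trans (le_of_eq ?_)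
  rw [hsK, div_pow]
  have : √(N : ℝ) ^ 3 = N * √N := by rw [pow_succ, sq, hNN]
  rw [this]
  field_simp

namespace AdaptiveSMC

variable {E : ℕ → Type*} [∀ n, MeasurableSpace (E n)] {d : ℕ} (S : AdaptiveSMC E d)

theorem nonempty_state (S : AdaptiveSMC E d) (n : ℕ) : Nonempty (E n) := by
  induction n with
  | zero => exact S.init.nonempty_of_neZero
  | succ n ih =>
    obtain ⟨x⟩ := ih
    exact (S.M n (0, x)).nonempty_of_neZero

/-! ### The law of the particles -/

theorem map_eval_zero_particleLaw (N : ℕ) :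
    (S.particleLaw N).map (fun w => w 0) = Measure.pi fun _ : Fin N => S.init := by
  have hk : (S.particleLaw N).map (Preorder.frestrictLe (π := fun n => Fin N → E n) 0) =
      (Measure.pi fun _ : Fin N => S.init).map
        (MeasurableEquiv.piUnique (fun i : Finset.Iic 0 => Fin N → E i)).symm := by
    rw [particleLaw, Kernel.trajMeasure, Measure.map_comp _ _ (by fun_prop),
      Kernel.traj_map_frestrictLe, Kernel.partialTraj_self, Measure.id_comp]
    rfl
  have he : (fun w : Π n, Fin N → E n => w 0) =
      (fun w : Π i : Finset.Iic 0, Fin N → E i => w ⟨0, Finset.mem_Iic.2 le_rfl⟩) ∘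
        Preorder.frestrictLe (π := fun n => Fin N → E n) 0 := rfl
  have hm : Measurable (fun w : Π i : Finset.Iic 0, Fin N → E i =>
      w ⟨0, Finset.mem_Iic.2 le_rfl⟩) := measurable_pi_apply _
  rw [he, ← Measure.map_map hm (Preorder.measurable_frestrictLe 0), hk]
  refine (Measure.map_map hm (MeasurableEquiv.measurable _)).trans ?_
  exact Measure.map_id

theorem integral_particleLaw_zero {V : Type*} [NormedAddCommGroup V] [NormedSpace ℝ V] (N : ℕ)
    {g : (Fin N → E 0) → V} (hg : StronglyMeasurable g) :
    ∫ x, g (x 0) ∂(S.particleLaw N) = ∫ y, g y ∂(Measure.pi fun _ => S.init) := by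
  have hm : Measurable fun w : Π p, Fin N → E p => w 0 := measurable_pi_apply 0
  rw [← S.map_eval_zero_particleLaw, integral_map hm.aemeasurable hg.aestronglyMeasurable]

/-- Given the first generations, the particles at time `n + 1` are independent with law
`Φ_{n+1,N}(η_n^N)`. -/
theorem integral_particleLaw_succ {V : Type*} [NormedAddCommGroup V] [NormedSpace ℝ V]
    (N n : ℕ) {F : (Π p, Fin N → E p) → (Fin N → E (n + 1)) → V}
    (hF : StronglyMeasurable (Function.uncurry F)) {C : ℝ} (hC : ∀ x y, ‖F x y‖ ≤ C)
    (hdep : ∀ x x' y, (∀ p ≤ n, x p = x' p) → F x y = F x' y) :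
    ∫ x, F x (x (n + 1)) ∂(S.particleLaw N) =
      ∫ x, ∫ y, F x y ∂(Measure.pi fun _ : Fin N => S.Phi n (empirical (x n)))
        ∂(S.particleLaw N) := by
  have hne := S.nonempty_state
  -- The trajectory law is disintegrated over finite histories, whereas `F` takes whole
  -- trajectories. A history is padded with arbitrary states, which `hdep` makes harmless.
  let ext : (Π i : Finset.Iic n, Fin N → E i) → Π p, Fin N → E p := fun u p =>
    if h : p ≤ n then u ⟨p, Finset.mem_Iic.2 h⟩ else fun _ => (hne p).some
  have hext : Measurable ext := by
    refine measurable_pi_lambda _ fun p => ?_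
    by_cases h : p ≤ n
    · simp only [ext, h, dite_true]; exact measurable_pi_apply _
    · simp only [ext, h, dite_false]; exact measurable_const
  have hr : ∀ x y, F x y = F (ext (Preorder.frestrictLe n x)) y := fun x y => by
    refine hdep _ _ _ fun p hp => ?_
    simp [ext, hp, Preorder.frestrictLe]
  let H : (Π i : Finset.Iic n, Fin N → E i) × (Fin N → E (n + 1)) → V := fun z => F (ext z.1) z.2
  have hH : StronglyMeasurable H := by
    have : Measurable fun z : (Π i : Finset.Iic n, Fin N → E i) × (Fin N → E (n + 1)) =>
        (ext z.1, z.2) := (hext.comp measurable_fst).prodMk measurable_snd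
    exact hF.comp_measurable this
  let κ : Kernel (Π i : Finset.Iic n, Fin N → E i) (Fin N → E (n + 1)) :=
    (S.particleKernel N n).comap (fun x => x ⟨n, Finset.mem_Iic.2 le_rfl⟩) (measurable_pi_apply _)
  have hmap : (S.particleLaw N).map (Preorder.frestrictLe n) ⊗ₘ κ =
      (S.particleLaw N).map (fun x => (Preorder.frestrictLe n x, x (n + 1))) :=
    Kernel.map_frestrictLe_trajMeasure_compProd_eq_map_trajMeasure
      (X := fun n => Fin N → E n) (a := n)
  have hm : Measurable fun x : Π p, Fin N → E p => (Preorder.frestrictLe n x, x (n + 1)) :=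
    (Preorder.measurable_frestrictLe n).prodMk (measurable_pi_apply _)
  have : IsProbabilityMeasure ((S.particleLaw N).map
      (Preorder.frestrictLe (π := fun n => Fin N → E n) n)) :=
    Measure.isProbabilityMeasure_map (Preorder.measurable_frestrictLe n).aemeasurable
  have h1 : ∫ x, F x (x (n + 1)) ∂(S.particleLaw N) =
      ∫ z, H z ∂((S.particleLaw N).map (Preorder.frestrictLe n) ⊗ₘ κ) := by
    rw [hmap, integral_map hm.aemeasurable hH.aestronglyMeasurable]
    exact integral_congr_ae (ae_of_all _ fun x => hr _ _)
  rw [h1, Measure.integral_compProd (Integrable.of_bound hH.aestronglyMeasurable C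
    (ae_of_all _ fun z => hC _ _)), integral_map
      (Preorder.measurable_frestrictLe n).aemeasurable]
  · refine integral_congr_ae (ae_of_all _ fun x => ?_)
    change ∫ y, F (ext (Preorder.frestrictLe n x)) y ∂(κ (Preorder.frestrictLe n x)) = _
    exact integral_congr_ae (ae_of_all _ fun y => (hr _ _).symm)
  · exact hH.integral_kernel_prod_right'.aestronglyMeasurable

/-! ### Operators and measures -/

theorem measurable_Qop {V : Type*} [NormedAddCommGroup V] [NormedSpace ℝ V] [MeasurableSpace V]
    [BorelSpace V] [SecondCountableTopology V] [CompleteSpace V] (n : ℕ)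
    (ξ : EuclideanSpace ℝ (Fin d))
    {φ : E (n + 1) → V} (hφ : Measurable φ) : Measurable (S.Qop n ξ φ) := by
  have h : S.Qop n ξ φ = fun x => S.G n ξ x • ∫ y, φ y ∂(S.M n (ξ, x)) := by
    funext x
    rw [Qop, Q_apply, integral_smul_measure, ENNReal.toReal_ofReal (S.G_pos n ξ x).le]
  rw [h]
  refine ((S.measurable_G n).comp measurable_prodMk_left).smul ?_
  have : StronglyMeasurable fun z : EuclideanSpace ℝ (Fin d) × E n => ∫ y, φ y ∂(S.M n z) :=
    hφ.stronglyMeasurable.integral_kernel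
  exact (this.comp_measurable measurable_prodMk_left).measurable

variable {S}

theorem A1.exists_G_le (h : S.A1) (n : ℕ) : ∃ C : ℝ, ∀ x ξ, S.G n ξ x ≤ C := by
  obtain ⟨C, hC⟩ := (h n).1
  exact ⟨C, fun x ξ => (le_abs_self _).trans (hC x ξ)⟩

theorem A1.isFiniteKernel_Q (h : S.A1) (n : ℕ) (ξ : EuclideanSpace ℝ (Fin d)) :
    IsFiniteKernel (S.Q n ξ) := by
  obtain ⟨C, hC⟩ := h.exists_G_le n
  refine ⟨⟨ENNReal.ofReal C, ENNReal.ofReal_lt_top, fun x => ?_⟩⟩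
  rw [Q_apply, Measure.smul_apply, measure_univ, smul_eq_mul, mul_one]
  exact ENNReal.ofReal_le_ofReal (hC x ξ)

theorem A1.isFiniteMeasure_gamma (h : S.A1) (n : ℕ) : IsFiniteMeasure (S.gamma n) := by
  induction n with
  | zero => rw [gamma_zero]; infer_instance
  | succ n ih =>
    have := h.isFiniteKernel_Q n (S.param n)
    rw [gamma_succ]
    infer_instance

/-- Strictly positive potentials never annihilate mass, so the normalisation defining `eta` is
legitimate. -/
theorem gamma_ne_zero (S : AdaptiveSMC E d) (n : ℕ) : S.gamma n ≠ 0 := by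
  induction n with
  | zero => rw [gamma_zero]; exact IsProbabilityMeasure.ne_zero _
  | succ n ih =>
    rw [gamma_succ, ← Measure.measure_univ_pos,
      Measure.bind_apply MeasurableSet.univ (Kernel.aemeasurable _)]
    simp only [Q_apply, Measure.smul_apply, measure_univ, smul_eq_mul, mul_one]
    rw [lintegral_pos_iff_support (S.measurable_ofReal_G n _)]
    have : Function.support (fun x => ENNReal.ofReal (S.G n (S.param n) x)) = Set.univ := by
      ext x
      simpa using S.G_pos n _ x
    rw [this]
    exact Measure.measure_univ_pos.2 ih

theorem A1.isProbabilityMeasure_eta (h : S.A1) (n : ℕ) : IsProbabilityMeasure (S.eta n) := by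
  have := h.isFiniteMeasure_gamma n
  refine ⟨?_⟩
  rw [eta, Measure.smul_apply, smul_eq_mul]
  exact ENNReal.inv_mul_cancel (Measure.measure_univ_ne_zero.2 (gamma_ne_zero S n))
    (measure_ne_top _ _)

theorem A1.gamma_univ_pos (h : S.A1) (n : ℕ) : 0 < (S.gamma n).real Set.univ := by
  have := h.isFiniteMeasure_gamma n
  exact ENNReal.toReal_pos (Measure.measure_univ_ne_zero.2 (gamma_ne_zero S n))
    (measure_ne_top _ _)

theorem A1.integral_gamma_eq {V : Type*} [NormedAddCommGroup V] [NormedSpace ℝ V]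
    (h : S.A1) (n : ℕ) (f : E n → V) :
    ∫ x, f x ∂(S.gamma n) = (S.gamma n).real Set.univ • ∫ x, f x ∂(S.eta n) := by
  have hp := h.gamma_univ_pos n
  rw [eta, integral_smul_measure, smul_smul, ENNReal.toReal_inv]
  change _ = ((S.gamma n).real Set.univ * ((S.gamma n).real Set.univ)⁻¹) • _
  rw [mul_inv_cancel₀ hp.ne', one_smul]

theorem A1.integral_bind_Q (h : S.A1) (n : ℕ) (ξ : EuclideanSpace ℝ (Fin d)) (μ : Measure (E n))
    [IsFiniteMeasure μ] {f : E (n + 1) → ℝ} (hf : IsBoundedMeasurable f) :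
    ∫ y, f y ∂(μ.bind (S.Q n ξ)) = ∫ x, S.Qop n ξ f x ∂μ := by
  have := h.isFiniteKernel_Q n ξ
  rw [← Measure.snd_compProd, Measure.snd, integral_map measurable_snd.aemeasurable
    hf.1.aestronglyMeasurable, Measure.integral_compProd]
  · rfl
  · exact integrable_of_isBoundedMeasurable (φ := fun z : E n × E (n + 1) => f z.2)
      ⟨hf.1.comp measurable_snd, hf.2.imp fun C hC z => hC _⟩ _

theorem A1.integral_gamma_succ (h : S.A1) (n : ℕ) {f : E (n + 1) → ℝ}
    (hf : IsBoundedMeasurable f) :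
    ∫ y, f y ∂(S.gamma (n + 1)) = ∫ x, S.Qop n (S.param n) f x ∂(S.gamma n) := by
  have := h.isFiniteMeasure_gamma n
  rw [gamma_succ, h.integral_bind_Q _ _ _ hf]

theorem A1.isBoundedMeasurable_Qop (h : S.A1) (n : ℕ) (ξ : EuclideanSpace ℝ (Fin d))
    {f : E (n + 1) → ℝ} (hf : IsBoundedMeasurable f) : IsBoundedMeasurable (S.Qop n ξ f) := by
  obtain ⟨C, hC⟩ := ((h n).2.2.2 f hf).1
  exact ⟨S.measurable_Qop n ξ hf.1, C, fun x => hC x ξ⟩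

/-! ### The particle approximation -/

variable (S)

/-- The parameter `η_n^N(ξ_{n+1})`. -/
noncomputable def paramN {N : ℕ} (n : ℕ) (x : Π p, Fin N → E p) : EuclideanSpace ℝ (Fin d) :=
  ∫ z, S.stat n z ∂(empirical (x n))

/-- The weight `γ_n^N(1) = ∏_{p<n} η_p^N(G_{p,N})`. -/
noncomputable def weight {N : ℕ} (n : ℕ) (x : Π p, Fin N → E p) : ℝ :=
  ∏ p ∈ Finset.range n, ∫ z, S.G p (S.paramN p x) z ∂(empirical (x p))

theorem gammaN_eq {V : Type*} [NormedAddCommGroup V] [NormedSpace ℝ V] {N : ℕ} (n : ℕ)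
    (f : E n → V) (x : Π p, Fin N → E p) :
    S.gammaN n f x = S.weight n x • ∫ z, f z ∂(empirical (x n)) := rfl

theorem weight_succ {N : ℕ} (n : ℕ) (x : Π p, Fin N → E p) :
    S.weight (n + 1) x = S.weight n x * ∫ z, S.G n (S.paramN n x) z ∂(empirical (x n)) :=
  Finset.prod_range_succ _ _

theorem measurable_paramN (N n : ℕ) :
    Measurable fun x : Π p, Fin N → E p => S.paramN n x :=
  (S.measurable_mean_stat N n).comp (measurable_pi_apply n)

theorem measurable_weight (N n : ℕ) : Measurable fun x : Π p, Fin N → E p => S.weight n x := by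
  refine Finset.measurable_fun_prod _ fun p _ => ?_
  have h : ∀ ξ, StronglyMeasurable fun z => S.G p ξ z := fun ξ =>
    ((S.measurable_G p).comp measurable_prodMk_left).stronglyMeasurable
  simp_rw [fun x : Π p, Fin N → E p => integral_empirical (x p) (h (S.paramN p x)), smul_eq_mul]
  refine measurable_const.mul (Finset.measurable_fun_sum _ fun i _ => ?_)
  exact (S.measurable_G p).comp ((S.measurable_paramN N p).prodMk
    ((measurable_pi_apply i).comp (measurable_pi_apply p)))

theorem measurable_gammaN (N n : ℕ) {f : E n → ℝ} (hf : Measurable f) :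
    Measurable fun x : Π p, Fin N → E p => S.gammaN n f x :=
  (S.measurable_weight N n).mul
    ((measurable_integral_empirical hf N).comp (measurable_pi_apply n))

theorem weight_congr {N n : ℕ} {x x' : Π p, Fin N → E p} (h : ∀ p < n, x p = x' p) :
    S.weight n x = S.weight n x' := by
  refine Finset.prod_congr rfl fun p hp => ?_
  rw [paramN, paramN, h p (Finset.mem_range.1 hp)]

theorem gammaN_congr {N n : ℕ} {x x' : Π p, Fin N → E p} (h : ∀ p ≤ n, x p = x' p)
    (f : E n → ℝ) : S.gammaN n f x = S.gammaN n f x' := by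
  rw [gammaN_eq, gammaN_eq, S.weight_congr fun p hp => h p hp.le, h n le_rfl]

theorem weight_nonneg {N : ℕ} (n : ℕ) (x : Π p, Fin N → E p) : 0 ≤ S.weight n x :=
  Finset.prod_nonneg fun _ _ => integral_nonneg fun z => (S.G_pos _ _ z).le

variable {S}

/-- A deterministic bound, uniform in `N`, which allows the random weight to be pulled out of every
error term. -/
theorem A1.exists_weight_le (h : S.A1) (n : ℕ) :
    ∃ C : ℝ, 0 ≤ C ∧ ∀ N ≠ 0, ∀ x : Π p, Fin N → E p, S.weight n x ≤ C := by
  induction n with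
  | zero => exact ⟨1, zero_le_one, fun N _ x => by simp [weight]⟩
  | succ n ih =>
    obtain ⟨C, hC0, hC⟩ := ih
    obtain ⟨K, hK⟩ := (h n).1
    refine ⟨C * |K|, by positivity, fun N hN x => ?_⟩
    have := isProbabilityMeasure_empirical hN (x n)
    rw [weight_succ]
    refine mul_le_mul (hC N hN x) ?_ (integral_nonneg fun z => (S.G_pos _ _ z).le) hC0
    refine (le_abs_self _).trans ((abs_integral_le_of_abs_le (fun z => hK z _) _).trans
      (le_abs_self _))

/-- The normalising constant of `Phi` is exactly the factor gained by the weight from `n` to `n +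
1`, so it cancels. The common value is the conditional mean of `gammaN (n + 1) f` given the first
generations. -/
theorem A1.gammaN_Qop (h : S.A1) {N n : ℕ} (hN : N ≠ 0) (x : Π p, Fin N → E p)
    {f : E (n + 1) → ℝ} (hf : IsBoundedMeasurable f) :
    S.gammaN n (S.Qop n (S.paramN n x) f) x =
      S.weight (n + 1) x * ∫ y, f y ∂(S.Phi n (empirical (x n))) := by
  have := isProbabilityMeasure_empirical hN (x n)
  have hG : ∫⁻ z, ENNReal.ofReal (S.G n (S.paramN n x) z) ∂(empirical (x n)) =
      ENNReal.ofReal (∫ z, S.G n (S.paramN n x) z ∂(empirical (x n))) := by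
    refine (ofReal_integral_eq_lintegral_ofReal ?_ (ae_of_all _ fun z => (S.G_pos _ _ z).le)).symm
    obtain ⟨K, hK⟩ := (h n).1
    exact Integrable.of_bound ((S.measurable_G n).comp measurable_prodMk_left).aestronglyMeasurable
      K (ae_of_all _ fun z => hK z _)
  have hpos : 0 < ∫ z, S.G n (S.paramN n x) z ∂(empirical (x n)) := by
    rw [← ENNReal.ofReal_pos, ← hG, lintegral_pos_iff_support (S.measurable_ofReal_G n _)]
    have : Function.support (fun z => ENNReal.ofReal (S.G n (S.paramN n x) z)) = Set.univ := by
      ext z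
      simpa using S.G_pos n _ z
    rw [this, measure_univ]
    exact one_pos
  have hPhi : ∫ y, f y ∂(S.Phi n (empirical (x n))) =
      (∫ z, S.G n (S.paramN n x) z ∂(empirical (x n)))⁻¹ *
        ∫ z, S.Qop n (S.paramN n x) f z ∂(empirical (x n)) := by
    rw [Phi, integral_smul_measure, ← h.integral_bind_Q _ _ _ hf, smul_eq_mul]
    congr 1
    change (∫⁻ z, ENNReal.ofReal (S.G n (S.paramN n x) z) ∂(empirical (x n)))⁻¹.toReal = _
    rw [hG, ENNReal.toReal_inv, ENNReal.toReal_ofReal hpos.le]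
  rw [gammaN_eq, weight_succ, hPhi, smul_eq_mul, mul_assoc, ← mul_assoc (∫ z, _ ∂_) (_⁻¹),
    mul_inv_cancel₀ hpos.ne', one_mul]

/-! ### Parameters in `Dom` and expansion of `Q` around the limiting parameter. -/

variable {Dom : ℕ → Set (EuclideanSpace ℝ (Fin d))}

theorem A1.isBoundedMeasurable_stat (h : S.A1) (n : ℕ) : IsBoundedMeasurable (S.stat n) :=
  ⟨S.measurable_stat n, (h n).2.2.1⟩

theorem A1.isBoundedMeasurable_stat_apply (h : S.A1) (n : ℕ) (j : Fin d) :
    IsBoundedMeasurable fun x => S.stat n x j := by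
  obtain ⟨C, hC⟩ := (h n).2.2.1
  have := S.measurable_stat n
  exact ⟨by fun_prop, C, fun x => (PiLp.norm_apply_le _ _).trans (hC x)⟩

/-- Both the limiting and the empirical parameters are barycentres of the range of the statistic.
Differentiability is only assumed on `Dom`, which need not be closed; hence the finite-dimensional
barycentre lemma. -/
theorem A1.integral_stat_mem (h : S.A1) (hconv : ∀ n, Convex ℝ (Dom n))
    (hrange : ∀ n, Set.range (S.stat n) ⊆ Dom n) (n : ℕ) (μ : Measure (E n))
    [IsProbabilityMeasure μ] : ∫ z, S.stat n z ∂μ ∈ Dom n :=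
  (hconv n).integral_mem_of_finiteDimensional
    (integrable_of_isBoundedMeasurable (h.isBoundedMeasurable_stat n) μ)
    (ae_of_all _ fun _ => hrange n (Set.mem_range_self _))

theorem A1.param_mem (h : S.A1) (hconv : ∀ n, Convex ℝ (Dom n))
    (hrange : ∀ n, Set.range (S.stat n) ⊆ Dom n) (n : ℕ) : S.param n ∈ Dom n := by
  have := h.isProbabilityMeasure_eta n
  exact h.integral_stat_mem hconv hrange n (S.eta n)

theorem A1.paramN_mem (h : S.A1) (hconv : ∀ n, Convex ℝ (Dom n))
    (hrange : ∀ n, Set.range (S.stat n) ⊆ Dom n) {N n : ℕ} (hN : N ≠ 0)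
    (x : Π p, Fin N → E p) : S.paramN n x ∈ Dom n := by
  have := isProbabilityMeasure_empirical hN (x n)
  exact h.integral_stat_mem hconv hrange n (empirical (x n))

/-- Lipschitz bound for `ξ ↦ Q_{n+1,ξ} f` at the limiting parameter, uniformly in `x`. -/
theorem A2.exists_abs_Qop_sub_le (h : S.A2 Dom) (hconv : ∀ n, Convex ℝ (Dom n))
    (n : ℕ) (hmem : S.param n ∈ Dom n) {f : E (n + 1) → ℝ} (hf : IsBoundedMeasurable f) :
    ∃ K : ℝ, 0 ≤ K ∧ ∀ x, ∀ ξ ∈ Dom n,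
      |S.Qop n ξ f x - S.Qop n (S.param n) f x| ≤ K * ‖ξ - S.param n‖ := by
  obtain ⟨hd, ⟨C, hC⟩, -⟩ := h n f hf
  refine ⟨|C|, abs_nonneg _, fun x ξ hξ => ?_⟩
  exact (hconv n).norm_image_sub_le_of_norm_fderiv_le (𝕜 := ℝ) (f := fun ζ => S.Qop n ζ f x)
    (hd x) (fun ζ hζ => (hC x ζ hζ).trans (le_abs_self C)) hmem hξ

theorem A2.exists_norm_dQ_le (h : S.A2 Dom) (n : ℕ) (hmem : S.param n ∈ Dom n)
    {f : E (n + 1) → ℝ} (hf : IsBoundedMeasurable f) :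
    ∃ K : ℝ, 0 ≤ K ∧ ∀ x, ‖S.dQ n (S.param n) f x‖ ≤ K := by
  obtain ⟨-, ⟨C, hC⟩, -⟩ := h n f hf
  exact ⟨|C|, abs_nonneg _, fun x => (hC x _ hmem).trans (le_abs_self C)⟩

/-- First-order expansion of `ξ ↦ Q_{n+1,ξ} f` at the limiting parameter, uniformly in `x`. -/
theorem A2.exists_abs_Qop_sub_sub_le (h : S.A2 Dom) (hconv : ∀ n, Convex ℝ (Dom n))
    (n : ℕ) (hmem : S.param n ∈ Dom n) {f : E (n + 1) → ℝ} (hf : IsBoundedMeasurable f)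
    {ε : ℝ} (hε : 0 < ε) :
    ∃ K : ℝ, 0 ≤ K ∧ ∀ x, ∀ ξ ∈ Dom n,
      |S.Qop n ξ f x - S.Qop n (S.param n) f x - S.dQ n (S.param n) f x (ξ - S.param n)| ≤
        ε * ‖ξ - S.param n‖ + K * ‖ξ - S.param n‖ ^ 2 := by
  obtain ⟨K₁, hK₁, h₁⟩ := h.exists_abs_Qop_sub_le hconv n hmem hf
  obtain ⟨K₂, hK₂, h₂⟩ := h.exists_norm_dQ_le n hmem hf
  obtain ⟨δ, hδ, hcont⟩ := (h n f hf).2.2 ε hε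
  have hd := (h n f hf).1
  -- Within distance `δ` the mean value inequality with the `ε` of continuity suffices. Beyond it,
  -- `‖v‖ ≤ ‖v‖ ^ 2 / δ` turns the crude bound `(K₁ + K₂) * ‖v‖` into the quadratic term.
  refine ⟨(K₁ + K₂) / δ, by positivity, fun x ξ hξ => ?_⟩
  have hK : 0 ≤ (K₁ + K₂) / δ := by positivity
  rcases lt_or_ge ‖ξ - S.param n‖ δ with hlt | hge
  · have hs : Convex ℝ (Dom n ∩ Metric.ball (S.param n) δ) :=
      (hconv n).inter (convex_ball _ _)
    have := hs.norm_image_sub_le_of_norm_fderiv_le' (𝕜 := ℝ) (f := fun ζ => S.Qop n ζ f x)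
      (φ := S.dQ n (S.param n) f x) (C := ε) (fun ζ hζ => hd x ζ hζ.1)
      (fun ζ hζ => by
        have := hcont x ζ hζ.1 hζ.2
        rw [dist_eq_norm] at this
        exact this.le)
      (⟨hmem, Metric.mem_ball_self hδ⟩) (y := ξ) ⟨hξ, by rwa [mem_ball_iff_norm]⟩
    exact this.trans (le_add_of_nonneg_right (by positivity))
  · have hA : |S.dQ n (S.param n) f x (ξ - S.param n)| ≤ K₂ * ‖ξ - S.param n‖ :=
      (ContinuousLinearMap.le_opNorm _ _).trans
        (mul_le_mul_of_nonneg_right (h₂ x) (norm_nonneg _))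
    have hB := h₁ x ξ hξ
    have hC : (K₁ + K₂) * ‖ξ - S.param n‖ ≤ (K₁ + K₂) / δ * ‖ξ - S.param n‖ ^ 2 := by
      rw [div_mul_eq_mul_div, le_div_iff₀ hδ, sq, mul_assoc]
      refine mul_le_mul_of_nonneg_left ?_ (by positivity)
      exact mul_le_mul_of_nonneg_left hge (norm_nonneg _)
    have := abs_sub (S.Qop n ξ f x - S.Qop n (S.param n) f x)
      (S.dQ n (S.param n) f x (ξ - S.param n))
    have : 0 ≤ ε * ‖ξ - S.param n‖ := by positivity
    linarith

/-! ### Measurability and integrability of the derivative. -/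

section Measurability

variable {V : Type*} [NormedAddCommGroup V] [NormedSpace ℝ V] [MeasurableSpace V] [BorelSpace V]
  [SecondCountableTopology V] [CompleteSpace V]

/-- A directional derivative is a pointwise limit of the difference quotients with steps `1 / k`. -/
theorem measurable_dQ_apply (S : AdaptiveSMC E d) (n : ℕ) (ξ : EuclideanSpace ℝ (Fin d))
    {φ : E (n + 1) → V}
    (hφ : Measurable φ) (hd : ∀ x, DifferentiableAt ℝ (fun ζ => S.Qop n ζ φ x) ξ)
    (v : EuclideanSpace ℝ (Fin d)) : Measurable fun x => S.dQ n ξ φ x v := by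
  refine measurable_of_tendsto_metrizable (f := fun (k : ℕ) x =>
    (k : ℝ) • (S.Qop n (ξ + (k : ℝ)⁻¹ • v) φ x - S.Qop n ξ φ x)) (fun k => ?_) ?_
  · exact ((S.measurable_Qop n _ hφ).sub (S.measurable_Qop n _ hφ)).const_smul _
  · rw [tendsto_pi_nhds]
    intro x
    refine (hd x).hasFDerivAt.lim v ?_
    exact tendsto_norm_atTop_atTop.comp tendsto_natCast_atTop_atTop

theorem integrable_dQ (S : AdaptiveSMC E d) (n : ℕ) (ξ : EuclideanSpace ℝ (Fin d))
    {φ : E (n + 1) → V}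
    (hφ : Measurable φ) (hd : ∀ x, DifferentiableAt ℝ (fun ζ => S.Qop n ζ φ x) ξ)
    {C : ℝ} (hC : ∀ x, ‖S.dQ n ξ φ x‖ ≤ C) (μ : Measure (E n)) [IsFiniteMeasure μ] :
    Integrable (fun x => S.dQ n ξ φ x) μ := by
  have h1 : ∀ j : Fin d, Integrable
      (fun x => S.dQ n ξ φ x (EuclideanSpace.single j (1 : ℝ))) μ := fun j =>
    Integrable.of_bound (S.measurable_dQ_apply n ξ hφ hd _).aestronglyMeasurable C
      (ae_of_all _ fun x => by
        refine (ContinuousLinearMap.le_opNorm _ _).trans ?_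
        simpa using hC x)
  -- Integrability in the space of linear maps is obtained coordinatewise: the derivative is the sum
  -- over `j` of its value at the `j`-th basis vector tensored with the `j`-th projection.
  have h2 := fun j : Fin d => (ContinuousLinearMap.smulRightL ℝ (EuclideanSpace ℝ (Fin d)) V
    (EuclideanSpace.proj j)).integrable_comp (h1 j)
  refine (integrable_finsetSum Finset.univ fun j _ => h2 j).congr (ae_of_all _ fun x => ?_)
  ext v
  simp only [_root_.sum_apply, ContinuousLinearMap.smulRightL_apply_apply]
  have hv : v = ∑ j, v j • EuclideanSpace.single j (1 : ℝ) := by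
    simpa using ((EuclideanSpace.basisFun (Fin d) ℝ).sum_repr v).symm
  conv_rhs => rw [hv, map_sum]
  simp

end Measurability

theorem A2.isBoundedMeasurable_dQ_apply (hA2 : S.A2 Dom) (n : ℕ) (hmem : S.param n ∈ Dom n)
    {f : E (n + 1) → ℝ} (hf : IsBoundedMeasurable f) (v : EuclideanSpace ℝ (Fin d)) :
    IsBoundedMeasurable fun x => S.dQ n (S.param n) f x v := by
  obtain ⟨K, hK0, hK⟩ := hA2.exists_norm_dQ_le n hmem hf
  exact ⟨S.measurable_dQ_apply n _ hf.1 (fun x => (hA2 n f hf).1 x _ hmem) v, K * ‖v‖, fun x =>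
    (ContinuousLinearMap.le_opNorm _ _).trans (mul_le_mul_of_nonneg_right (hK x) (norm_nonneg _))⟩

theorem A2.integrable_dQ (hA2 : S.A2 Dom) (n : ℕ) (hmem : S.param n ∈ Dom n)
    {f : E (n + 1) → ℝ} (hf : IsBoundedMeasurable f) (μ : Measure (E n)) [IsFiniteMeasure μ] :
    Integrable (fun x => S.dQ n (S.param n) f x) μ := by
  obtain ⟨K, hK0, hK⟩ := hA2.exists_norm_dQ_le n hmem hf
  exact S.integrable_dQ n _ hf.1 (fun x => (hA2 n f hf).1 x _ hmem) hK μ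

/-! ### The operator `L` on scalar functions. -/

theorem A1.isBoundedMeasurable_L (hA1 : S.A1) (n : ℕ) {f : E (n + 1) → ℝ}
    (hf : IsBoundedMeasurable f) : IsBoundedMeasurable (S.L n f) := by
  set T := ∫ z, S.dQ n (S.param n) f z ∂(S.eta n) with hT
  obtain ⟨hm, C, hC⟩ := hA1.isBoundedMeasurable_stat n
  obtain ⟨hm', C', hC'⟩ := hA1.isBoundedMeasurable_Qop n (S.param n) hf
  refine ⟨(T.continuous.measurable.comp (hm.sub_const _)).add hm',
    ‖T‖ * (C + ‖S.param n‖) + C', fun x => ?_⟩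
  refine (norm_add_le _ _).trans (add_le_add ?_ (hC' x))
  refine (T.le_opNorm _).trans (mul_le_mul_of_nonneg_left ?_ (norm_nonneg _))
  exact (norm_sub_le _ _).trans (add_le_add (hC x) le_rfl)

theorem A1.integral_L (hA1 : S.A1) (n : ℕ) {f : E (n + 1) → ℝ}
    (hf : IsBoundedMeasurable f) (μ : Measure (E n)) [IsProbabilityMeasure μ] :
    ∫ x, S.L n f x ∂μ = (∫ z, S.dQ n (S.param n) f z ∂(S.eta n))
      (∫ x, S.stat n x ∂μ - S.param n) + ∫ x, S.Qop n (S.param n) f x ∂μ := by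
  set T := ∫ z, S.dQ n (S.param n) f z ∂(S.eta n) with hT
  have h1 : Integrable (fun x => S.stat n x - S.param n) μ :=
    (integrable_of_isBoundedMeasurable (hA1.isBoundedMeasurable_stat n) μ).sub (integrable_const _)
  have h2 := integrable_of_isBoundedMeasurable (hA1.isBoundedMeasurable_Qop n (S.param n) hf) μ
  change ∫ x, (T (S.stat n x - S.param n) + S.Qop n (S.param n) f x) ∂μ = _
  rw [integral_add (T.integrable_comp h1) h2, T.integral_comp_comm h1, integral_sub
    (integrable_of_isBoundedMeasurable (hA1.isBoundedMeasurable_stat n) μ) (integrable_const _)]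
  simp

/-- The affine correction has zero mean, `S.param n` being the mean of the statistic under `eta n`.
This makes the backward recursion of the errors exact at the level of the limiting measures. -/
theorem A1.integral_gamma_L (hA1 : S.A1) (n : ℕ) {f : E (n + 1) → ℝ}
    (hf : IsBoundedMeasurable f) :
    ∫ x, S.L n f x ∂(S.gamma n) = ∫ y, f y ∂(S.gamma (n + 1)) := by
  have := hA1.isProbabilityMeasure_eta n
  rw [hA1.integral_gamma_succ n hf, hA1.integral_gamma_eq, hA1.integral_gamma_eq n (S.Qop _ _ _),
    hA1.integral_L n hf]
  change _ • ((∫ z, S.dQ n (S.param n) f z ∂(S.eta n)) (S.param n - S.param n) + _) = _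
  simp

/-! ### Orders of magnitude of functions of the particles -/

/-- The functions `Y N` of `N` particles have mean `O(1 / N)`. -/
def IsMeanO (S : AdaptiveSMC E d) (Y : ∀ N, (Π p, Fin N → E p) → ℝ) : Prop :=
  ∃ C : ℝ, 0 ≤ C ∧ ∀ N ≠ 0, Integrable (Y N) (S.particleLaw N) ∧
    ∫ x, Y N x ∂(S.particleLaw N) ≤ C / N

/-- The functions `X N` of `N` particles have mean square `O(1 / N)`. -/
def IsRootN (S : AdaptiveSMC E d) (X : ∀ N, (Π p, Fin N → E p) → ℝ) : Prop :=
  (∀ N ≠ 0, Measurable (X N)) ∧ S.IsMeanO fun N x => X N x ^ 2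

theorem IsMeanO.add {Y Z : ∀ N, (Π p, Fin N → E p) → ℝ} (hY : S.IsMeanO Y) (hZ : S.IsMeanO Z) :
    S.IsMeanO fun N x => Y N x + Z N x := by
  obtain ⟨C, hC0, hC⟩ := hY
  obtain ⟨K, hK0, hK⟩ := hZ
  refine ⟨C + K, by positivity, fun N hN => ⟨(hC N hN).1.add (hK N hN).1, ?_⟩⟩
  rw [integral_add (hC N hN).1 (hK N hN).1, add_div]
  exact add_le_add (hC N hN).2 (hK N hN).2

theorem IsMeanO.const_mul {Y : ∀ N, (Π p, Fin N → E p) → ℝ} (hY : S.IsMeanO Y) {c : ℝ}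
    (hc : 0 ≤ c) : S.IsMeanO fun N x => c * Y N x := by
  obtain ⟨C, hC0, hC⟩ := hY
  refine ⟨c * C, by positivity, fun N hN => ⟨(hC N hN).1.const_mul c, ?_⟩⟩
  rw [integral_const_mul, mul_div_assoc]
  exact mul_le_mul_of_nonneg_left (hC N hN).2 hc

theorem IsMeanO.sum {ι : Type*} (s : Finset ι) {Y : ι → ∀ N, (Π p, Fin N → E p) → ℝ}
    (hY : ∀ i ∈ s, S.IsMeanO (Y i)) : S.IsMeanO fun N x => ∑ i ∈ s, Y i N x := by
  classical
  induction s using Finset.induction_on with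
  | empty => exact ⟨0, le_rfl, fun N _ => by simp⟩
  | insert i s hi ih =>
    simp_rw [Finset.sum_insert hi]
    exact (hY i (Finset.mem_insert_self _ _)).add
      (ih fun j hj => hY j (Finset.mem_insert_of_mem hj))

theorem IsMeanO.mono {Y Z : ∀ N, (Π p, Fin N → E p) → ℝ} (hY : S.IsMeanO Y)
    (hZ : ∀ N ≠ 0, Measurable (Z N)) (h0 : ∀ N ≠ 0, ∀ x, 0 ≤ Z N x)
    (hle : ∀ N ≠ 0, ∀ x, Z N x ≤ Y N x) : S.IsMeanO Z := by
  obtain ⟨C, hC0, hC⟩ := hY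
  have hi : ∀ N ≠ 0, Integrable (Z N) (S.particleLaw N) := fun N hN =>
    (hC N hN).1.mono' (hZ N hN).aestronglyMeasurable (ae_of_all _ fun x => by
      rw [Real.norm_eq_abs, abs_of_nonneg (h0 N hN x)]; exact hle N hN x)
  exact ⟨C, hC0, fun N hN => ⟨hi N hN,
    (integral_mono (hi N hN) (hC N hN).1 (hle N hN)).trans (hC N hN).2⟩⟩

theorem IsRootN.of_abs_le {X Y : ∀ N, (Π p, Fin N → E p) → ℝ} (hX : S.IsRootN X)
    (hY : ∀ N ≠ 0, Measurable (Y N)) {K : ℝ} (hle : ∀ N ≠ 0, ∀ x, |Y N x| ≤ K * |X N x|) :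
    S.IsRootN Y := by
  refine ⟨hY, (hX.2.const_mul (sq_nonneg K)).mono (fun N hN => (hY N hN).pow_const 2)
    (fun N _ x => sq_nonneg _) fun N hN x => ?_⟩
  rw [← sq_abs, ← sq_abs (X N x), ← mul_pow]
  exact pow_le_pow_left₀ (abs_nonneg _) (hle N hN x) 2

theorem IsRootN.add {X Y : ∀ N, (Π p, Fin N → E p) → ℝ} (hX : S.IsRootN X) (hY : S.IsRootN Y) :
    S.IsRootN fun N x => X N x + Y N x := by
  refine ⟨fun N hN => (hX.1 N hN).add (hY.1 N hN),
    ((hX.2.add hY.2).const_mul zero_le_two).mono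
      (fun N hN => ((hX.1 N hN).add (hY.1 N hN)).pow_const 2)
      (fun N _ x => sq_nonneg _) fun N hN x => ?_⟩
  nlinarith [sq_nonneg (X N x - Y N x)]

theorem IsRootN.const_mul {X : ∀ N, (Π p, Fin N → E p) → ℝ} (hX : S.IsRootN X) (c : ℝ) :
    S.IsRootN fun N x => c * X N x :=
  hX.of_abs_le (K := |c|) (fun N hN => (hX.1 N hN).const_mul c) fun _ _ _ => (abs_mul _ _).le

theorem IsRootN.abs {X : ∀ N, (Π p, Fin N → E p) → ℝ} (hX : S.IsRootN X) :
    S.IsRootN fun N x => |X N x| :=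
  hX.of_abs_le (K := 1) (fun N hN => (hX.1 N hN).abs) fun N _ x => by simp

theorem IsRootN.sum {ι : Type*} (s : Finset ι) {X : ι → ∀ N, (Π p, Fin N → E p) → ℝ}
    (hX : ∀ i ∈ s, S.IsRootN (X i)) : S.IsRootN fun N x => ∑ i ∈ s, X i N x := by
  classical
  induction s using Finset.induction_on with
  | empty => exact ⟨fun N _ => by simp, 0, le_rfl, fun N _ => by simp⟩
  | insert i s hi ih =>
    simp_rw [Finset.sum_insert hi]
    exact (hX i (Finset.mem_insert_self _ _)).add
      (ih fun j hj => hX j (Finset.mem_insert_of_mem hj))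

theorem IsRootN.congr {X Y : ∀ N, (Π p, Fin N → E p) → ℝ} (hX : S.IsRootN X)
    (h : ∀ N ≠ 0, ∀ x, Y N x = X N x) : S.IsRootN Y := by
  have e : ∀ N ≠ 0, Y N = X N := fun N hN => funext (h N hN)
  exact hX.of_abs_le (K := 1) (fun N hN => e N hN ▸ hX.1 N hN) fun N hN x => by
    rw [h N hN, one_mul]

/-- The inequality `√N |X| ≤ (1 + N X²) / 2` plays the role of Cauchy–Schwarz. -/
theorem IsRootN.sqrt_mul_integral_abs_le {X : ∀ N, (Π p, Fin N → E p) → ℝ} (hX : S.IsRootN X) :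
    ∃ C : ℝ, 0 ≤ C ∧ ∀ N ≠ 0, Integrable (fun x => |X N x|) (S.particleLaw N) ∧
      √(N : ℝ) * ∫ x, |X N x| ∂(S.particleLaw N) ≤ C := by
  obtain ⟨hm, C, hC0, hC⟩ := hX
  refine ⟨(1 + C) / 2, by positivity, fun N hN => ?_⟩
  have hNpos : (0 : ℝ) < N := by exact_mod_cast Nat.pos_of_ne_zero hN
  have hs : 0 < √(N : ℝ) := Real.sqrt_pos.2 hNpos
  have hss : √(N : ℝ) ^ 2 = N := Real.sq_sqrt hNpos.le
  have hle : ∀ x, √(N : ℝ) * |X N x| ≤ (1 + N * X N x ^ 2) / 2 := fun x => by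
    have := sq_nonneg (1 - √(N : ℝ) * |X N x|)
    rw [sub_sq, mul_pow, hss, sq_abs] at this
    linarith
  have hg : Integrable (fun x => (1 + N * X N x ^ 2) / 2) (S.particleLaw N) :=
    ((integrable_const _).add ((hC N hN).1.const_mul _)).div_const 2
  have hi : Integrable (fun x => √(N : ℝ) * |X N x|) (S.particleLaw N) :=
    hg.mono' ((hm N hN).abs.const_mul _).aestronglyMeasurable (ae_of_all _ fun x => by
      rw [Real.norm_eq_abs, abs_of_nonneg (by positivity)]; exact hle x)
  refine ⟨(integrable_const_mul_iff (isUnit_iff_ne_zero.2 hs.ne') _).1 hi, ?_⟩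
  rw [← integral_const_mul]
  refine (integral_mono hi hg hle).trans ?_
  rw [integral_div, integral_add (integrable_const _) ((hC N hN).1.const_mul _),
    integral_const_mul]
  have := mul_le_mul_of_nonneg_left (hC N hN).2 hNpos.le
  rw [mul_div_cancel₀ _ hNpos.ne'] at this
  simp only [integral_const, probReal_univ, one_smul]
  linarith

theorem tendsto_sqrt_inv_natCast : Tendsto (fun N : ℕ => (√(N : ℝ))⁻¹) atTop (𝓝 0) :=
  (Real.tendsto_sqrt_atTop.comp tendsto_natCast_atTop_atTop).inv_tendsto_atTop

theorem IsRootN.tendsto_integral_abs {X : ∀ N, (Π p, Fin N → E p) → ℝ} (hX : S.IsRootN X) :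
    Tendsto (fun N => ∫ x, |X N x| ∂(S.particleLaw N)) atTop (𝓝 0) := by
  obtain ⟨C, hC0, hC⟩ := hX.sqrt_mul_integral_abs_le
  refine squeeze_zero' (g := fun N : ℕ => C * (√(N : ℝ))⁻¹)
    (Eventually.of_forall fun N => integral_nonneg fun x => abs_nonneg _) ?_ ?_
  · filter_upwards [eventually_ne_atTop 0] with N hN
    have hs : 0 < √(N : ℝ) := Real.sqrt_pos.2 (by exact_mod_cast Nat.pos_of_ne_zero hN)
    rw [← div_eq_mul_inv, le_div_iff₀ hs, mul_comm]
    exact (hC N hN).2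
  · simpa using tendsto_sqrt_inv_natCast.const_mul C

/-- A criterion for the functions `R N` to be `o(1 / √N)` in mean. -/
theorem tendsto_sqrt_mul_integral_abs {R Z : ∀ N, (Π p, Fin N → E p) → ℝ}
    (hR : ∀ N ≠ 0, Measurable (R N)) (hZ : S.IsRootN Z)
    (h : ∀ ε > 0, ∃ Y, S.IsMeanO Y ∧ ∀ N ≠ 0, ∀ x, |R N x| ≤ ε * |Z N x| + Y N x) :
    Tendsto (fun N : ℕ => √(N : ℝ) * ∫ x, |R N x| ∂(S.particleLaw N)) atTop (𝓝 0) := by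
  obtain ⟨C, hC0, hC⟩ := hZ.sqrt_mul_integral_abs_le
  rw [Metric.tendsto_nhds]
  intro η hη
  -- The `Z` term then costs at most `η / 2`; the `+ 1` covers `C = 0`. The `Y` term costs `K / √N`,
  -- eventually below `η / 2`.
  obtain ⟨Y, ⟨K, hK0, hK⟩, hY⟩ := h (η / (2 * (C + 1))) (by positivity)
  have hlim : Tendsto (fun N : ℕ => K * (√(N : ℝ))⁻¹) atTop (𝓝 0) := by
    simpa using tendsto_sqrt_inv_natCast.const_mul K
  filter_upwards [eventually_ne_atTop 0, hlim.eventually (gt_mem_nhds (half_pos hη))] with N hN hlt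
  have hNpos : (0 : ℝ) < N := by exact_mod_cast Nat.pos_of_ne_zero hN
  have hs : 0 < √(N : ℝ) := Real.sqrt_pos.2 hNpos
  have hg : Integrable (fun x => η / (2 * (C + 1)) * |Z N x| + Y N x) (S.particleLaw N) :=
    ((hC N hN).1.const_mul _).add (hK N hN).1
  have hi : Integrable (fun x => |R N x|) (S.particleLaw N) :=
    hg.mono' (hR N hN).abs.aestronglyMeasurable (ae_of_all _ fun x => by
      rw [Real.norm_eq_abs, abs_abs]; exact hY N hN x)
  have h1 := integral_mono hi hg (hY N hN)
  rw [integral_add ((hC N hN).1.const_mul _) (hK N hN).1, integral_const_mul] at h1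
  have h2 := mul_le_mul_of_nonneg_left h1 hs.le
  have h3 : √(N : ℝ) * (K / N) = K * (√(N : ℝ))⁻¹ := by
    have : √(N : ℝ) * √N = N := Real.mul_self_sqrt hNpos.le
    rw [← div_eq_mul_inv, eq_div_iff hs.ne']
    rw [mul_right_comm, this]
    field_simp
  have h4 := mul_le_mul_of_nonneg_left (hK N hN).2 hs.le
  have h5 : √(N : ℝ) * (η / (2 * (C + 1)) * ∫ x, |Z N x| ∂(S.particleLaw N)) ≤ η / 2 := by
    have e : √(N : ℝ) * (η / (2 * (C + 1)) * ∫ x, |Z N x| ∂(S.particleLaw N)) =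
      η / (2 * (C + 1)) * (√(N : ℝ) * ∫ x, |Z N x| ∂(S.particleLaw N)) := by ring
    rw [e]
    refine (mul_le_mul_of_nonneg_left (hC N hN).2 (by positivity)).trans ?_
    rw [div_mul_eq_mul_div, div_le_div_iff₀ (by positivity) two_pos]
    nlinarith
  rw [Real.dist_eq, sub_zero, abs_of_nonneg (mul_nonneg hs.le
    (integral_nonneg fun x => abs_nonneg _))]
  rw [mul_add] at h2
  linarith

/-! ### Mean square error of the particle approximation -/

/-- `Phi` is recovered as the law of the first particle under `particleKernel`, which turns it into
a kernel and explains the condition on `N`. -/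
theorem measurable_integral_Phi (S : AdaptiveSMC E d) {N : ℕ} (hN : N ≠ 0) (n : ℕ)
    {f : E (n + 1) → ℝ} (hf : Measurable f) :
    Measurable fun x : Π p, Fin N → E p => ∫ y, f y ∂(S.Phi n (empirical (x n))) := by
  have : Nonempty (Fin N) := ⟨⟨0, Nat.pos_of_ne_zero hN⟩⟩
  have hP := fun x : Fin N → E n => S.isProbabilityMeasure_Phi hN x
  let κ : Kernel (Fin N → E n) (E (n + 1)) :=
    (S.particleKernel N n).map fun y => y ⟨0, Nat.pos_of_ne_zero hN⟩
  have hκ : ∀ x, κ x = S.Phi n (empirical x) := fun x => by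
    rw [Kernel.map_apply _ (measurable_pi_apply _)]
    exact (measurePreserving_eval (fun _ : Fin N => S.Phi n (empirical x))
      ⟨0, Nat.pos_of_ne_zero hN⟩).map_eq
  have hmk : IsMarkovKernel κ := ⟨fun x => by rw [hκ]; infer_instance⟩
  have h : StronglyMeasurable fun x : Fin N → E n => ∫ y, f y ∂(κ x) :=
    hf.stronglyMeasurable.integral_kernel
  simp_rw [hκ] at h
  exact h.measurable.comp (measurable_pi_apply n)

/-- The sampling error at time `n + 1`. -/
noncomputable def sampErr (S : AdaptiveSMC E d) (n : ℕ) (f : E (n + 1) → ℝ) (N : ℕ)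
    (x : Π p, Fin N → E p) : ℝ :=
  S.weight (n + 1) x *
    (∫ z, f z ∂(empirical (x (n + 1))) - ∫ y, f y ∂(S.Phi n (empirical (x n))))

/-- The error due to the linearisation of the adaptation at time `n`. -/
noncomputable def linErr (S : AdaptiveSMC E d) (n : ℕ) (f : E (n + 1) → ℝ) (N : ℕ)
    (x : Π p, Fin N → E p) : ℝ :=
  S.gammaN n (S.Qop n (S.paramN n x) f) x - S.gammaN n (S.L n f) x

theorem measurable_sampErr (S : AdaptiveSMC E d) (n : ℕ) {f : E (n + 1) → ℝ} (hf : Measurable f)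
    {N : ℕ} (hN : N ≠ 0) : Measurable (S.sampErr n f N) :=
  (S.measurable_weight N _).mul (((measurable_integral_empirical hf N).comp
    (measurable_pi_apply _)).sub (S.measurable_integral_Phi hN n hf))

/-- The random parameter sits inside `Qop`; rewriting through `gammaN_Qop` moves the question to
`Phi`, already known to be measurable. -/
theorem A1.measurable_linErr (h : S.A1) (n : ℕ) {f : E (n + 1) → ℝ} (hf : IsBoundedMeasurable f)
    {N : ℕ} (hN : N ≠ 0) : Measurable (S.linErr n f N) := by
  unfold linErr
  simp_rw [fun x : Π p, Fin N → E p => h.gammaN_Qop hN x hf]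
  exact ((S.measurable_weight N _).mul (S.measurable_integral_Phi hN n hf.1)).sub
    (S.measurable_gammaN N n (h.isBoundedMeasurable_L n hf).1)

/-- The conditional mean of `gammaN (n + 1) f` and the quantity `gammaN n (L n f)` are inserted in
turn. The remaining deterministic terms agree by `integral_gamma_L`. -/
theorem A1.gammaN_succ_sub (h : S.A1) (n : ℕ) {f : E (n + 1) → ℝ} (hf : IsBoundedMeasurable f)
    {N : ℕ} (hN : N ≠ 0) (x : Π p, Fin N → E p) :
    S.gammaN (n + 1) f x - ∫ y, f y ∂(S.gamma (n + 1)) =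
      (S.gammaN n (S.L n f) x - ∫ y, S.L n f y ∂(S.gamma n)) + S.linErr n f N x +
        S.sampErr n f N x := by
  rw [linErr, sampErr, h.gammaN_Qop hN x hf, h.integral_gamma_L n hf, gammaN_eq _ (n + 1),
    smul_eq_mul]
  ring

theorem measurable_sampErr_uncurry (S : AdaptiveSMC E d) (n : ℕ) {f : E (n + 1) → ℝ}
    (hf : Measurable f) {N : ℕ} (hN : N ≠ 0) :
    Measurable fun z : (Π p, Fin N → E p) × (Fin N → E (n + 1)) =>
      S.weight (n + 1) z.1 * (∫ z, f z ∂(empirical z.2) -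
        ∫ y, f y ∂(S.Phi n (empirical (z.1 n)))) :=
  ((S.measurable_weight N _).comp measurable_fst).mul
    (((measurable_integral_empirical hf N).comp measurable_snd).sub
      ((S.measurable_integral_Phi hN n hf).comp measurable_fst))

/-- Conditionally on the first `n` generations the weight is constant and the new particles are
independent, so the mean square bound for empirical means applies. -/
theorem A1.isRootN_sampErr (h : S.A1) (n : ℕ) {f : E (n + 1) → ℝ} (hf : IsBoundedMeasurable f) :
    S.IsRootN (S.sampErr n f) := by
  obtain ⟨hm, K, hK⟩ := id hf
  obtain ⟨C, hC0, hC⟩ := h.exists_weight_le (n + 1)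
  have hF : ∀ N ≠ 0, ∀ (x : Π p, Fin N → E p) (y : Fin N → E (n + 1)),
      ‖(S.weight (n + 1) x * (∫ z, f z ∂(empirical y) -
        ∫ y, f y ∂(S.Phi n (empirical (x n))))) ^ 2‖ ≤ (C * (K + K)) ^ 2 := by
    intro N hN x y
    have := isProbabilityMeasure_empirical hN y
    have := S.isProbabilityMeasure_Phi hN (x n)
    rw [norm_pow, norm_mul, Real.norm_eq_abs, abs_of_nonneg (S.weight_nonneg _ _)]
    refine pow_le_pow_left₀ (by have := S.weight_nonneg (n + 1) x; positivity) ?_ 2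
    refine mul_le_mul (hC N hN x) ?_ (norm_nonneg _) hC0
    exact (norm_sub_le _ _).trans (add_le_add (abs_integral_le_of_abs_le hK _)
      (abs_integral_le_of_abs_le hK _))
  refine ⟨fun N hN => S.measurable_sampErr n hm hN, C ^ 2 * K ^ 2, by positivity, fun N hN => ?_⟩
  refine ⟨Integrable.of_bound ((S.measurable_sampErr n hm hN).pow_const 2).aestronglyMeasurable _
    (ae_of_all _ fun x => hF N hN x _), ?_⟩
  have key := S.integral_particleLaw_succ N n (F := fun x y => (S.weight (n + 1) x *
      (∫ z, f z ∂(empirical y) - ∫ y, f y ∂(S.Phi n (empirical (x n))))) ^ 2)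
    ((S.measurable_sampErr_uncurry n hm hN).pow_const 2).stronglyMeasurable
    (hF N hN) (fun x x' y hx => by
      rw [S.weight_congr fun p hp => hx p (Nat.lt_succ_iff.1 hp), hx n le_rfl])
  change ∫ x, (S.weight (n + 1) x * (∫ z, f z ∂(empirical (x (n + 1))) -
    ∫ y, f y ∂(S.Phi n (empirical (x n))))) ^ 2 ∂_ ≤ _
  rw [key]
  refine (le_abs_self _).trans (abs_integral_le_of_abs_le (fun x => ?_) _)
  have := S.isProbabilityMeasure_Phi hN (x n)
  simp_rw [mul_pow]
  rw [integral_const_mul, abs_mul, abs_pow,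
    abs_of_nonneg (S.weight_nonneg _ _), abs_of_nonneg (integral_nonneg fun _ => sq_nonneg _),
    mul_div_assoc]
  exact mul_le_mul (pow_le_pow_left₀ (S.weight_nonneg _ _) (hC N hN x) 2)
    (integral_sq_empirical_sub_le hm hK hN) (integral_nonneg fun _ => sq_nonneg _) (by positivity)

/-- The unnormalised error `γ_n^N(f) - γ_n(f)`. -/
noncomputable def gammaErr (S : AdaptiveSMC E d) (n : ℕ) (f : E n → ℝ) (N : ℕ)
    (x : Π p, Fin N → E p) : ℝ :=
  S.gammaN n f x - ∫ y, f y ∂(S.gamma n)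

/-- The normalised error `η_n^N(f) - η_n(f)`. -/
noncomputable def etaErr (S : AdaptiveSMC E d) (n : ℕ) (f : E n → ℝ) (N : ℕ)
    (x : Π p, Fin N → E p) : ℝ :=
  ∫ y, f y ∂(empirical (x n)) - ∫ y, f y ∂(S.eta n)

theorem isBoundedMeasurable_const {X : Type*} [MeasurableSpace X] (c : ℝ) :
    IsBoundedMeasurable fun _ : X => c :=
  ⟨measurable_const, |c|, fun _ => le_rfl⟩

theorem gammaN_one (S : AdaptiveSMC E d) {N : ℕ} (hN : N ≠ 0) (n : ℕ) (x : Π p, Fin N → E p) :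
    S.gammaN n (fun _ => (1 : ℝ)) x = S.weight n x := by
  have := isProbabilityMeasure_empirical hN (x n)
  rw [gammaN_eq]; simp

/-- Write `w` for the weight, `c` for its limit and `δ` for the normalised error. Then `c δ = -(w -
c) δ + w δ`, where `w δ` is the unnormalised error of the centred function and `δ` is bounded. No
lower bound on the random weight is required. -/
theorem A1.isRootN_etaErr (h : S.A1) {n : ℕ}
    (hD : ∀ f : E n → ℝ, IsBoundedMeasurable f → S.IsRootN (S.gammaErr n f))
    {f : E n → ℝ} (hf : IsBoundedMeasurable f) : S.IsRootN (S.etaErr n f) := by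
  obtain ⟨hm, K, hK⟩ := id hf
  have := h.isFiniteMeasure_gamma n
  have := h.isProbabilityMeasure_eta n
  set c := (S.gamma n).real Set.univ with hc
  have hcpos : 0 < c := h.gamma_univ_pos n
  set m := ∫ y, f y ∂(S.eta n) with hmdef
  have hbm : IsBoundedMeasurable fun x => f x - m :=
    ⟨hm.sub_const m, K + ‖m‖, fun x => (norm_sub_le _ _).trans (add_le_add (hK x) le_rfl)⟩
  have hmeas : ∀ N, Measurable (S.etaErr n f N) := fun N =>
    ((measurable_integral_empirical hm N).comp (measurable_pi_apply n)).sub_const m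
  refine ((((hD _ (isBoundedMeasurable_const 1)).abs.const_mul (K + K)).add
    (hD _ hbm).abs).const_mul c⁻¹).of_abs_le (K := 1) (fun N _ => hmeas N) fun N hN x => ?_
  have := isProbabilityMeasure_empirical hN (x n)
  have h0 : ∫ y, (f y - m) ∂(S.gamma n) = 0 := by
    rw [h.integral_gamma_eq, integral_sub (integrable_of_isBoundedMeasurable hf _)
      (integrable_const _)]
    simp [hmdef]
  have e1 : S.gammaErr n (fun x => f x - m) N x = S.weight n x * S.etaErr n f N x := by
    rw [gammaErr, h0, gammaN_eq, integral_sub (integrable_of_isBoundedMeasurable hf _)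
      (integrable_const _), etaErr]
    simp [hmdef]
  have e2 : S.gammaErr n (fun _ => 1) N x = S.weight n x - c := by
    rw [gammaErr, S.gammaN_one hN]; simp [hc]
  have e3 : c * S.etaErr n f N x =
      -(S.gammaErr n (fun _ => 1) N x * S.etaErr n f N x) +
        S.gammaErr n (fun x => f x - m) N x := by
    rw [e1, e2]; ring
  have hb : |S.etaErr n f N x| ≤ K + K :=
    (abs_sub _ _).trans (add_le_add (abs_integral_le_of_abs_le hK _)
      (abs_integral_le_of_abs_le hK _))
  have hle : c * |S.etaErr n f N x| ≤ (K + K) * |S.gammaErr n (fun _ => 1) N x| +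
      |S.gammaErr n (fun x => f x - m) N x| := by
    rw [← abs_of_pos hcpos, ← abs_mul, e3]
    refine (abs_add_le _ _).trans (add_le_add ?_ le_rfl)
    rw [abs_neg, abs_mul, mul_comm]
    exact mul_le_mul_of_nonneg_right hb (abs_nonneg _)
  rw [one_mul, abs_mul, abs_of_pos (inv_pos.2 hcpos), inv_mul_eq_div, le_div_iff₀ hcpos, mul_comm]
  exact hle.trans (le_abs_self _)

theorem A1.integral_stat_apply (h : S.A1) (n : ℕ) (j : Fin d) (μ : Measure (E n))
    [IsFiniteMeasure μ] : (∫ z, S.stat n z ∂μ) j = ∫ z, S.stat n z j ∂μ :=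
  ((EuclideanSpace.proj (𝕜 := ℝ) j).integral_comp_comm
    (integrable_of_isBoundedMeasurable (h.isBoundedMeasurable_stat n) μ)).symm

theorem A1.paramN_sub_param_apply (h : S.A1) (n : ℕ) {N : ℕ} (hN : N ≠ 0)
    (x : Π p, Fin N → E p) (j : Fin d) :
    (S.paramN n x - S.param n) j = S.etaErr n (fun z => S.stat n z j) N x := by
  have := isProbabilityMeasure_empirical hN (x n)
  have := h.isProbabilityMeasure_eta n
  rw [PiLp.sub_apply, paramN, param, h.integral_stat_apply, h.integral_stat_apply, etaErr]

theorem norm_le_sum_abs_apply {ι : Type*} [Fintype ι] (v : EuclideanSpace ℝ ι) :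
    ‖v‖ ≤ ∑ j, |v j| := by
  classical
  have hv : v = ∑ j, v j • EuclideanSpace.single j (1 : ℝ) := by
    simpa using ((EuclideanSpace.basisFun ι ℝ).sum_repr v).symm
  conv_lhs => rw [hv]
  refine (norm_sum_le _ _).trans (Finset.sum_le_sum fun j _ => ?_)
  rw [norm_smul]
  simp

theorem A1.isRootN_paramErr (h : S.A1) {n : ℕ}
    (hη : ∀ f : E n → ℝ, IsBoundedMeasurable f → S.IsRootN (S.etaErr n f)) :
    S.IsRootN fun _ x => ‖S.paramN n x - S.param n‖ := by
  refine (IsRootN.sum Finset.univ fun j _ =>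
    (hη _ (h.isBoundedMeasurable_stat_apply n j)).abs).of_abs_le (K := 1)
    (fun N _ => ((S.measurable_paramN N n).sub_const _).norm) fun N hN x => ?_
  rw [abs_norm, one_mul]
  refine ((norm_le_sum_abs_apply _).trans (le_of_eq ?_)).trans (le_abs_self _)
  exact Finset.sum_congr rfl fun j _ => by rw [h.paramN_sub_param_apply n hN]

/-- Averaging `L n f` over the particles evaluates the derivative integrated against `eta n` at the
parameter error, because `paramN` is the empirical mean of the statistic. -/
theorem A1.linErr_eq (h : S.A1) (n : ℕ) {f : E (n + 1) → ℝ} (hf : IsBoundedMeasurable f)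
    {N : ℕ} (hN : N ≠ 0) (x : Π p, Fin N → E p) :
    S.linErr n f N x = S.weight n x *
      (∫ z, (S.Qop n (S.paramN n x) f z - S.Qop n (S.param n) f z) ∂(empirical (x n)) -
        (∫ z, S.dQ n (S.param n) f z ∂(S.eta n)) (S.paramN n x - S.param n)) := by
  have := isProbabilityMeasure_empirical hN (x n)
  rw [linErr, gammaN_eq, gammaN_eq, h.integral_L n hf, integral_sub
    (integrable_of_isBoundedMeasurable (h.isBoundedMeasurable_Qop n _ hf) _)
    (integrable_of_isBoundedMeasurable (h.isBoundedMeasurable_Qop n _ hf) _), paramN]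
  simp only [smul_eq_mul]
  ring

/-- A Lipschitz bound is enough for this size. The sharper Taylor estimate of `tendsto_linErr`
itself rests on the mean square errors that this bound yields. -/
theorem A1.isRootN_linErr (h : S.A1) (h2 : S.A2 Dom) (hconv : ∀ n, Convex ℝ (Dom n))
    (hrange : ∀ n, Set.range (S.stat n) ⊆ Dom n) {n : ℕ}
    (hη : ∀ f : E n → ℝ, IsBoundedMeasurable f → S.IsRootN (S.etaErr n f))
    {f : E (n + 1) → ℝ} (hf : IsBoundedMeasurable f) : S.IsRootN (S.linErr n f) := by
  obtain ⟨K, hK0, hK⟩ := h2.exists_abs_Qop_sub_le hconv n (h.param_mem hconv hrange n) hf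
  obtain ⟨C, hC0, hC⟩ := h.exists_weight_le n
  set T := ∫ z, S.dQ n (S.param n) f z ∂(S.eta n) with hT
  refine (h.isRootN_paramErr hη).of_abs_le (K := C * (K + ‖T‖))
    (fun N hN => h.measurable_linErr n hf hN) fun N hN x => ?_
  have := isProbabilityMeasure_empirical hN (x n)
  rw [h.linErr_eq n hf hN, abs_mul, abs_of_nonneg (S.weight_nonneg _ _), abs_norm, mul_assoc,
    add_mul]
  refine mul_le_mul (hC N hN x) ((abs_sub _ _).trans (add_le_add ?_ (T.le_opNorm _)))
    (abs_nonneg _) hC0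
  exact abs_integral_le_of_abs_le (fun z => hK z _ (h.paramN_mem hconv hrange hN x)) _

/-- The induction must cover all `f` together: the step uses the previous time on `L n f` and, for
the parameter error, on functions built from the coordinates of the statistic. -/
theorem A1.isRootN_gammaErr (h : S.A1) (h2 : S.A2 Dom) (hconv : ∀ n, Convex ℝ (Dom n))
    (hrange : ∀ n, Set.range (S.stat n) ⊆ Dom n) (n : ℕ) :
    ∀ f : E n → ℝ, IsBoundedMeasurable f → S.IsRootN (S.gammaErr n f) := by
  induction n with
  | zero =>
    rintro f ⟨hm, K, hK⟩
    refine ⟨fun N _ => (S.measurable_gammaN N 0 hm).sub_const _, K ^ 2, sq_nonneg _,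
      fun N hN => ?_⟩
    have hm2 : Measurable fun y : Fin N → E 0 =>
        (∫ z, f z ∂(empirical y) - ∫ z, f z ∂S.init) ^ 2 :=
      ((measurable_integral_empirical hm N).sub_const _).pow_const 2
    have e : ∀ x : Π p, Fin N → E p, S.gammaErr 0 f N x =
        ∫ z, f z ∂(empirical (x 0)) - ∫ z, f z ∂S.init := fun x => by
      rw [gammaErr, gammaN_eq, weight, gamma_zero, Finset.range_zero, Finset.prod_empty, one_smul]
    simp_rw [e]
    refine ⟨Integrable.of_bound (C := (K + K) ^ 2) ?_ (ae_of_all _ fun x => ?_), ?_⟩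
    · exact (hm2.comp (measurable_pi_apply 0)).aestronglyMeasurable
    · have := isProbabilityMeasure_empirical hN (x 0)
      rw [norm_pow]
      refine pow_le_pow_left₀ (norm_nonneg _) ?_ 2
      exact (norm_sub_le _ _).trans (add_le_add (abs_integral_le_of_abs_le hK _)
        (abs_integral_le_of_abs_le hK _))
    · refine (S.integral_particleLaw_zero N hm2.stronglyMeasurable).trans_le ?_
      exact integral_sq_empirical_sub_le hm hK hN
  | succ n ih =>
    intro f hf
    have hη : ∀ f : E n → ℝ, IsBoundedMeasurable f → S.IsRootN (S.etaErr n f) := fun f hf =>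
      h.isRootN_etaErr ih hf
    exact (((ih _ (h.isBoundedMeasurable_L n hf)).add
      (h.isRootN_linErr h2 hconv hrange hη hf)).add (h.isRootN_sampErr n hf)).congr
      fun N hN x => h.gammaN_succ_sub n hf hN x

/-! ### Linearisation of the adaptation -/

/-- Expanded in coordinates, the left side is a sum of products of two normalised errors, one of the
derivative and one of the statistic. Each product is bounded by a sum of squares, of mean `O(1 /
N)`. -/
theorem A2.abs_integral_dQ_sub_le (h2 : S.A2 Dom) (h : S.A1) {n : ℕ}
    (hmem : S.param n ∈ Dom n) {f : E (n + 1) → ℝ} (hf : IsBoundedMeasurable f)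
    {N : ℕ} (hN : N ≠ 0) (x : Π p, Fin N → E p) :
    |∫ z, S.dQ n (S.param n) f z (S.paramN n x - S.param n) ∂(empirical (x n)) -
        (∫ z, S.dQ n (S.param n) f z ∂(S.eta n)) (S.paramN n x - S.param n)| ≤
      ∑ j, (S.etaErr n (fun z => S.dQ n (S.param n) f z (EuclideanSpace.single j 1)) N x ^ 2 +
        S.etaErr n (fun z => S.stat n z j) N x ^ 2) := by
  have := isProbabilityMeasure_empirical hN (x n)
  have := h.isProbabilityMeasure_eta n
  have hi := h2.integrable_dQ n hmem hf
  set v := S.paramN n x - S.param n with hv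
  have hvj : ∀ j, v j = S.etaErr n (fun z => S.stat n z j) N x := fun j =>
    h.paramN_sub_param_apply n hN x j
  have hv' : v = ∑ j, v j • EuclideanSpace.single j (1 : ℝ) := by
    simpa using ((EuclideanSpace.basisFun (Fin d) ℝ).sum_repr v).symm
  have e : ∫ z, S.dQ n (S.param n) f z v ∂(empirical (x n)) -
        (∫ z, S.dQ n (S.param n) f z ∂(S.eta n)) v =
      ∑ j, v j *
        S.etaErr n (fun z => S.dQ n (S.param n) f z (EuclideanSpace.single j 1)) N x := by
    rw [← ContinuousLinearMap.integral_apply (hi (empirical (x n))),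
      ← _root_.sub_apply]
    conv_lhs => rw [hv', map_sum]
    refine Finset.sum_congr rfl fun j _ => ?_
    rw [map_smul, smul_eq_mul, _root_.sub_apply,
      ContinuousLinearMap.integral_apply (hi _), ContinuousLinearMap.integral_apply (hi _), etaErr]
  rw [e]
  refine (Finset.abs_sum_le_sum_abs _ _).trans (Finset.sum_le_sum fun j _ => ?_)
  rw [hvj]
  set a := S.etaErr n (fun z => S.stat n z j) N x
  set b := S.etaErr n (fun z => S.dQ n (S.param n) f z (EuclideanSpace.single j 1)) N x
  rw [abs_le]
  constructor <;> nlinarith [sq_nonneg (a + b), sq_nonneg (a - b), sq_nonneg a, sq_nonneg b]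

/-- The derivative at the limiting parameter is inserted under the empirical mean. The Taylor
remainder gives `ε ‖v‖ + K ‖v‖²`, and replacing the empirical measure by `eta n` costs only a sum of
squares. -/
theorem A1.tendsto_linErr (h : S.A1) (h2 : S.A2 Dom) (hconv : ∀ n, Convex ℝ (Dom n))
    (hrange : ∀ n, Set.range (S.stat n) ⊆ Dom n) (n : ℕ)
    {f : E (n + 1) → ℝ} (hf : IsBoundedMeasurable f) :
    Tendsto (fun N : ℕ => √(N : ℝ) * ∫ x, |S.linErr n f N x| ∂(S.particleLaw N))
      atTop (𝓝 0) := by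
  have hmem := h.param_mem hconv hrange n
  have hη : ∀ f : E n → ℝ, IsBoundedMeasurable f → S.IsRootN (S.etaErr n f) := fun f hf =>
    h.isRootN_etaErr (h.isRootN_gammaErr h2 hconv hrange n) hf
  have hZ := h.isRootN_paramErr hη
  obtain ⟨C, hC0, hC⟩ := h.exists_weight_le n
  refine tendsto_sqrt_mul_integral_abs (fun N hN => h.measurable_linErr n hf hN) hZ
    fun ε hε => ?_
  obtain ⟨K, hK0, hK⟩ := h2.exists_abs_Qop_sub_sub_le hconv n hmem hf
    -- Dividing by `C + 1` compensates for the bound `C` on the weight.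
    (ε := ε / (C + 1)) (by positivity)
  refine ⟨_, ((hZ.2.const_mul hK0).add (IsMeanO.sum Finset.univ fun j _ =>
    (hη _ (h2.isBoundedMeasurable_dQ_apply n hmem hf (EuclideanSpace.single j 1))).2.add
      (hη _ (h.isBoundedMeasurable_stat_apply n j)).2)).const_mul hC0, fun N hN x => ?_⟩
  have := isProbabilityMeasure_empirical hN (x n)
  have hA := h2.abs_integral_dQ_sub_le h hmem hf hN x
  set v := S.paramN n x - S.param n with hv
  set T := ∫ z, S.dQ n (S.param n) f z ∂(S.eta n) with hT
  have hiQ : Integrable (fun z => S.Qop n (S.paramN n x) f z - S.Qop n (S.param n) f z)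
      (empirical (x n)) :=
    (integrable_of_isBoundedMeasurable (h.isBoundedMeasurable_Qop n _ hf) _).sub
      (integrable_of_isBoundedMeasurable (h.isBoundedMeasurable_Qop n _ hf) _)
  have hid := integrable_of_isBoundedMeasurable (h2.isBoundedMeasurable_dQ_apply n hmem hf v)
    (empirical (x n))
  have e : ∫ z, (S.Qop n (S.paramN n x) f z - S.Qop n (S.param n) f z) ∂(empirical (x n)) - T v =
      ∫ z, (S.Qop n (S.paramN n x) f z - S.Qop n (S.param n) f z - S.dQ n (S.param n) f z v)
        ∂(empirical (x n)) + (∫ z, S.dQ n (S.param n) f z v ∂(empirical (x n)) - T v) := by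
    rw [integral_sub hiQ hid]; ring
  rw [h.linErr_eq n hf hN, e, abs_mul, abs_of_nonneg (S.weight_nonneg _ _)]
  have hB := abs_integral_le_of_abs_le
    (fun z => hK z _ (h.paramN_mem hconv hrange hN x)) (empirical (x n))
  have hsum := (abs_add_le _ _).trans (add_le_add hB hA)
  refine (mul_le_mul (hC N hN x) hsum (abs_nonneg _) hC0).trans ?_
  rw [abs_norm, mul_add, mul_add, mul_add, ← add_assoc]
  have hCε : C * (ε / (C + 1) * ‖v‖) ≤ ε * ‖v‖ := by
    rw [← mul_assoc]
    refine mul_le_mul_of_nonneg_right ?_ (norm_nonneg _)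
    rw [mul_div_assoc', div_le_iff₀ (by positivity)]
    nlinarith
  linarith

/-! ### Characteristic functions -/

/-- The asymptotic variance `∑_{p ≤ n} γ_p(1)² Var_{η_p}(𝓛_{p,n} f)`, by recursion on `n`. -/
noncomputable def asympVar (S : AdaptiveSMC E d) : ∀ n, (E n → ℝ) → ℝ
  | 0, f => ((S.gamma 0).real Set.univ) ^ 2 *
      (∫ x, f x ^ 2 ∂(S.eta 0) - (∫ x, f x ∂(S.eta 0)) ^ 2)
  | n + 1, f => ((S.gamma (n + 1)).real Set.univ) ^ 2 *
      (∫ x, f x ^ 2 ∂(S.eta (n + 1)) - (∫ x, f x ∂(S.eta (n + 1))) ^ 2) + asympVar S n (S.L n f)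

theorem isBoundedMeasurable_sq {X : Type*} [MeasurableSpace X] {f : X → ℝ}
    (hf : IsBoundedMeasurable f) : IsBoundedMeasurable fun x => f x ^ 2 := by
  obtain ⟨hm, K, hK⟩ := hf
  refine ⟨hm.pow_const 2, K ^ 2, fun x => ?_⟩
  rw [norm_pow]
  exact pow_le_pow_left₀ (norm_nonneg _) (hK x) 2

theorem sq_integral_le_integral_sq {X : Type*} [MeasurableSpace X] {f : X → ℝ}
    (hf : IsBoundedMeasurable f) (μ : Measure X) [IsProbabilityMeasure μ] :
    (∫ x, f x ∂μ) ^ 2 ≤ ∫ x, f x ^ 2 ∂μ := by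
  have hi := integrable_of_isBoundedMeasurable hf μ
  have hi2 := integrable_of_isBoundedMeasurable (isBoundedMeasurable_sq hf) μ
  set m := ∫ x, f x ∂μ with hm
  have h0 : 0 ≤ ∫ x, (f x - m) ^ 2 ∂μ := integral_nonneg fun x => sq_nonneg _
  have h3 : Integrable (fun x => 2 * m * f x - m ^ 2) μ :=
    (hi.const_mul _).sub (integrable_const _)
  have e : ∀ x, (f x - m) ^ 2 = f x ^ 2 - (2 * m * f x - m ^ 2) := fun x => by ring
  simp_rw [e] at h0
  rw [integral_sub hi2 h3, integral_sub (hi.const_mul _) (integrable_const _),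
    integral_const_mul, ← hm] at h0
  simp only [integral_const, probReal_univ, one_smul] at h0
  linarith

theorem norm_cexp_mul_I_sub_cexp_mul_I_le (a b : ℝ) :
    ‖Complex.exp (a * Complex.I) - Complex.exp (b * Complex.I)‖ ≤ |a - b| := by
  have e : Complex.exp (a * Complex.I) - Complex.exp (b * Complex.I) =
      Complex.exp (b * Complex.I) * (Complex.exp (Complex.I * (a - b : ℝ)) - 1) := by
    rw [mul_sub, ← Complex.exp_add, mul_one]
    congr 2
    push_cast
    ring
  rw [e, norm_mul, Complex.norm_exp_ofReal_mul_I, one_mul]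
  exact Real.norm_exp_I_mul_ofReal_sub_one_le

theorem abs_exp_neg_sub_exp_neg_le {a b : ℝ} (ha : 0 ≤ a) (hb : 0 ≤ b) :
    |Real.exp (-a) - Real.exp (-b)| ≤ |a - b| := by
  wlog hab : a ≤ b generalizing a b
  · rw [abs_sub_comm, abs_sub_comm a]
    exact this hb ha (le_of_not_ge hab)
  have h1 : Real.exp (-b) ≤ Real.exp (-a) := Real.exp_le_exp.2 (by linarith)
  rw [abs_of_nonneg (by linarith), abs_of_nonpos (by linarith)]
  have h2 : Real.exp (-b) = Real.exp (-a) * Real.exp (-(b - a)) := by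
    rw [← Real.exp_add]; ring_nf
  have h3 := Real.add_one_le_exp (-(b - a))
  have h4 : Real.exp (-a) ≤ 1 := Real.exp_le_one_iff.2 (by linarith)
  have h5 := Real.exp_pos (-a)
  nlinarith

/-- The conditional variance of the sampling error, multiplied by `N`. -/
noncomputable def condVar (S : AdaptiveSMC E d) (n : ℕ) (f : E (n + 1) → ℝ) (N : ℕ)
    (x : Π p, Fin N → E p) : ℝ :=
  S.weight (n + 1) x ^ 2 * (∫ y, f y ^ 2 ∂(S.Phi n (empirical (x n))) -
    (∫ y, f y ∂(S.Phi n (empirical (x n)))) ^ 2)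

theorem measurable_condVar (S : AdaptiveSMC E d) (n : ℕ) {f : E (n + 1) → ℝ} (hf : Measurable f)
    {N : ℕ} (hN : N ≠ 0) : Measurable (S.condVar n f N) :=
  ((S.measurable_weight N _).pow_const 2).mul
    ((S.measurable_integral_Phi hN n (hf.pow_const 2)).sub
      ((S.measurable_integral_Phi hN n hf).pow_const 2))

theorem condVar_nonneg (S : AdaptiveSMC E d) (n : ℕ) {f : E (n + 1) → ℝ}
    (hf : IsBoundedMeasurable f) {N : ℕ} (hN : N ≠ 0) (x : Π p, Fin N → E p) :
    0 ≤ S.condVar n f N x := by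
  have := S.isProbabilityMeasure_Phi hN (x n)
  exact mul_nonneg (sq_nonneg _) (sub_nonneg.2 (sq_integral_le_integral_sq hf _))

/-- This conditional mean is the particle estimate minus its sampling error, both of which are
controlled. -/
theorem A1.isRootN_weight_mul_Phi (h : S.A1) (h2 : S.A2 Dom) (hconv : ∀ n, Convex ℝ (Dom n))
    (hrange : ∀ n, Set.range (S.stat n) ⊆ Dom n) (n : ℕ)
    {f : E (n + 1) → ℝ} (hf : IsBoundedMeasurable f) :
    S.IsRootN fun _ x => S.weight (n + 1) x * ∫ y, f y ∂(S.Phi n (empirical (x n))) -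
      ∫ y, f y ∂(S.gamma (n + 1)) :=
  ((h.isRootN_gammaErr h2 hconv hrange (n + 1) f hf).add
    ((h.isRootN_sampErr n hf).const_mul (-1))).congr fun _ _ x => by
      rw [gammaErr, sampErr, gammaN_eq, smul_eq_mul]; ring

/-- With `p` and `p₂` the means of `f` and `f ^ 2` under `Phi`, the conditional variance `w ^ 2 (p₂
- p ^ 2)` is `w (w p₂) - (w p) ^ 2`, a polynomial in three bounded quantities, each within mean
square `O(1 / N)` of its limit. The limit of `w` comes from the constant function `1`. -/
theorem A1.tendsto_condVar (h : S.A1) (h2 : S.A2 Dom) (hconv : ∀ n, Convex ℝ (Dom n))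
    (hrange : ∀ n, Set.range (S.stat n) ⊆ Dom n) (n : ℕ)
    {f : E (n + 1) → ℝ} (hf : IsBoundedMeasurable f) :
    Tendsto (fun N : ℕ => ∫ x, |S.condVar n f N x - ((S.gamma (n + 1)).real Set.univ) ^ 2 *
      (∫ x, f x ^ 2 ∂(S.eta (n + 1)) - (∫ x, f x ∂(S.eta (n + 1))) ^ 2)| ∂(S.particleLaw N))
      atTop (𝓝 0) := by
  have hr := fun (f : E (n + 1) → ℝ) (hf : IsBoundedMeasurable f) =>
    h.isRootN_weight_mul_Phi h2 hconv hrange n hf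
  obtain ⟨hm, K, hK⟩ := id hf
  obtain ⟨-, K₂, hK₂⟩ := isBoundedMeasurable_sq hf
  obtain ⟨C, hC0, hC⟩ := h.exists_weight_le (n + 1)
  set c₁ := (S.gamma (n + 1)).real Set.univ with hc₁
  set b := ∫ y, f y ∂(S.gamma (n + 1)) with hb
  set b₂ := ∫ y, f y ^ 2 ∂(S.gamma (n + 1)) with hb₂
  have hlim : c₁ ^ 2 * (∫ x, f x ^ 2 ∂(S.eta (n + 1)) - (∫ x, f x ∂(S.eta (n + 1))) ^ 2) =
      c₁ * b₂ - b ^ 2 := by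
    rw [hb, hb₂, h.integral_gamma_eq, h.integral_gamma_eq, smul_eq_mul, smul_eq_mul]
    ring
  rw [hlim]
  refine IsRootN.tendsto_integral_abs (IsRootN.of_abs_le (K := 1)
    (((hr _ (isBoundedMeasurable_const 1)).abs.const_mul (C * K₂)).add
      (((hr _ (isBoundedMeasurable_sq hf)).abs.const_mul |c₁|).add
        ((hr _ hf).abs.const_mul (C * K + |b|))))
    (fun N hN => (S.measurable_condVar n hm hN).sub_const _) fun N hN x => ?_)
  have := S.isProbabilityMeasure_Phi hN (x n)
  rw [one_mul, condVar]
  refine le_trans ?_ (le_abs_self _)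
  set w := S.weight (n + 1) x with hw
  set p := ∫ y, f y ∂(S.Phi n (empirical (x n)))
  set p₂ := ∫ y, f y ^ 2 ∂(S.Phi n (empirical (x n)))
  have hwC : |w| ≤ C := by
    rw [abs_of_nonneg (S.weight_nonneg _ _)]; exact hC N hN x
  have hp : |w * p| ≤ C * K := by
    rw [abs_mul]
    exact mul_le_mul hwC (abs_integral_le_of_abs_le hK _) (abs_nonneg _) hC0
  have hp₂ : |w * p₂| ≤ C * K₂ := by
    rw [abs_mul]
    exact mul_le_mul hwC (abs_integral_le_of_abs_le hK₂ _) (abs_nonneg _) hC0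
  have e1 : w * ∫ _, (1 : ℝ) ∂(S.Phi n (empirical (x n))) - ∫ _, (1 : ℝ) ∂(S.gamma (n + 1)) =
      w - c₁ := by simp [hc₁]
  rw [e1]
  have e2 : w ^ 2 * (p₂ - p ^ 2) - (c₁ * b₂ - b ^ 2) =
      (w * p₂) * (w - c₁) + (c₁ * (w * p₂ - b₂) + -((w * p + b) * (w * p - b))) := by ring
  rw [e2]
  refine (abs_add_le _ _).trans (add_le_add ?_ ((abs_add_le _ _).trans (add_le_add ?_ ?_)))
  · rw [abs_mul]; exact mul_le_mul_of_nonneg_right hp₂ (abs_nonneg _)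
  · rw [abs_mul]
  · rw [abs_neg, abs_mul]
    exact mul_le_mul_of_nonneg_right ((abs_add_le _ _).trans (add_le_add hp le_rfl)) (abs_nonneg _)

/-- Conditional central limit theorem for the sampling error. -/
theorem A1.tendsto_integral_cexp_sampErr (h : S.A1) (n : ℕ) {f : E (n + 1) → ℝ}
    (hf : IsBoundedMeasurable f) {g : E n → ℝ} (hg : Measurable g) :
    Tendsto (fun N : ℕ => ∫ x, Complex.exp ((√N * S.gammaErr n g N x : ℝ) * Complex.I) *
      (Complex.exp ((√N * S.sampErr n f N x : ℝ) * Complex.I) -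
        Complex.exp ((-(S.condVar n f N x / 2) : ℝ))) ∂(S.particleLaw N)) atTop (𝓝 0) := by
  obtain ⟨hm, K, hK⟩ := id hf
  obtain ⟨C, hC0, hC⟩ := h.exists_weight_le (n + 1)
  obtain ⟨y₀⟩ := S.nonempty_state (n + 1)
  have hK0 : 0 ≤ K := (norm_nonneg _).trans (hK y₀)
  refine squeeze_zero_norm' (a := fun N : ℕ => 2 * (C * (2 * K)) ^ 3 * (√(N : ℝ))⁻¹) ?_
    (by simpa using tendsto_sqrt_inv_natCast.const_mul (2 * (C * (2 * K)) ^ 3))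
  have hlarge : ∀ᶠ N : ℕ in atTop, C * (2 * K) ≤ √(N : ℝ) :=
    (Real.tendsto_sqrt_atTop.comp tendsto_natCast_atTop_atTop).eventually_ge_atTop _
  filter_upwards [eventually_ne_atTop 0, hlarge] with N hN hNl
  have hw : ∀ x : Π p, Fin N → E p, |S.weight (n + 1) x| ≤ C := fun x => by
    rw [abs_of_nonneg (S.weight_nonneg _ _)]; exact hC N hN x
  have hmeas : Measurable fun z : (Π p, Fin N → E p) × (Fin N → E (n + 1)) =>
      Complex.exp ((√N * S.gammaErr n g N z.1 : ℝ) * Complex.I) *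
      (Complex.exp ((√N * (S.weight (n + 1) z.1 * (∫ u, f u ∂(empirical z.2) -
        ∫ u, f u ∂(S.Phi n (empirical (z.1 n))))) : ℝ) * Complex.I) -
          Complex.exp ((-(S.condVar n f N z.1 / 2) : ℝ))) := by
    have h1 := S.measurable_sampErr_uncurry n hm hN
    have h2 : Measurable fun z : (Π p, Fin N → E p) × (Fin N → E (n + 1)) =>
      S.condVar n f N z.1 := (S.measurable_condVar n hm hN).comp measurable_fst
    have h3 : Measurable fun z : (Π p, Fin N → E p) × (Fin N → E (n + 1)) =>
      S.gammaErr n g N z.1 := ((S.measurable_gammaN N n hg).sub_const _).comp measurable_fst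
    exact (by fun_prop : Measurable fun z : (Π p, Fin N → E p) × (Fin N → E (n + 1)) =>
      Complex.exp ((√N * S.gammaErr n g N z.1 : ℝ) * Complex.I)).mul
      (((by fun_prop : Measurable fun u : ℝ => Complex.exp ((√N * u : ℝ) * Complex.I)).comp
        h1).sub ((by fun_prop : Measurable fun u : ℝ => Complex.exp ((-(u / 2) : ℝ))).comp h2))
  -- The factor carrying `g` and the conditional variance depend on the first `n` generations only,
  -- so they are frozen when generation `n + 1` is integrated out.
  have key := S.integral_particleLaw_succ N n (F := fun x y =>
      Complex.exp ((√N * S.gammaErr n g N x : ℝ) * Complex.I) *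
      (Complex.exp ((√N * (S.weight (n + 1) x * (∫ u, f u ∂(empirical y) -
        ∫ u, f u ∂(S.Phi n (empirical (x n))))) : ℝ) * Complex.I) -
          Complex.exp ((-(S.condVar n f N x / 2) : ℝ)))) hmeas.stronglyMeasurable
    (C := 2) (fun x y => by
      rw [norm_mul, Complex.norm_exp_ofReal_mul_I, one_mul]
      refine (norm_sub_le _ _).trans ?_
      rw [Complex.norm_exp_ofReal_mul_I, Complex.norm_exp_ofReal]
      have : Real.exp (-(S.condVar n f N x / 2)) ≤ 1 := Real.exp_le_one_iff.2 (by
        have := S.condVar_nonneg n hf hN x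
        linarith)
      linarith)
    (fun x x' y hx => by
      rw [gammaErr, gammaErr, condVar, condVar, S.gammaN_congr hx,
        S.weight_congr fun p hp => hx p (Nat.lt_succ_iff.1 hp), hx n le_rfl])
  change ‖∫ x, Complex.exp ((√N * S.gammaErr n g N x : ℝ) * Complex.I) *
      (Complex.exp ((√N * (S.weight (n + 1) x * (∫ u, f u ∂(empirical (x (n + 1))) -
        ∫ u, f u ∂(S.Phi n (empirical (x n))))) : ℝ) * Complex.I) -
          Complex.exp ((-(S.condVar n f N x / 2) : ℝ))) ∂(S.particleLaw N)‖ ≤ _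
  rw [key]
  refine (norm_integral_le_of_norm_le_const (C := 2 * (C * (2 * K)) ^ 3 * (√(N : ℝ))⁻¹)
    (ae_of_all _ fun x => ?_)).trans_eq ?_
  swap
  · rw [probReal_univ, mul_one]
  have := S.isProbabilityMeasure_Phi hN (x n)
  rw [integral_const_mul, norm_mul, Complex.norm_exp_ofReal_mul_I, one_mul, integral_sub _
    (integrable_const _), integral_const, probReal_univ, one_smul]
  · have hwK : |S.weight (n + 1) x| * (2 * K) ≤ C * (2 * K) :=
      mul_le_mul_of_nonneg_right (hw x) (by positivity)
    refine (norm_integral_cexp_empirical_sub_le hm hK hN (hwK.trans hNl)).trans ?_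
    rw [div_eq_mul_inv]
    gcongr
  · refine Integrable.of_bound (C := 1) (Measurable.aestronglyMeasurable ?_)
      (ae_of_all _ fun y => ?_)
    · have := measurable_integral_empirical hm N
      fun_prop
    · rw [Complex.norm_exp_ofReal_mul_I]

theorem eta_zero (S : AdaptiveSMC E d) : S.eta 0 = S.init := by
  rw [eta, gamma_zero, measure_univ, inv_one, one_smul]

/-- The exponential at time `n + 1` is compared with `exp (-c / 2)` times the exponential at time
`n` for `L n f`, to which the induction hypothesis applies. Three errors arise: dropping the
linearisation error, replacing the sampling factor by its conditional Gaussian value, and replacing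
`condVar` by `c`. -/
theorem A1.tendsto_integral_cexp_gammaErr (h : S.A1) (h2 : S.A2 Dom)
    (hconv : ∀ n, Convex ℝ (Dom n)) (hrange : ∀ n, Set.range (S.stat n) ⊆ Dom n) (n : ℕ) :
    ∀ f : E n → ℝ, IsBoundedMeasurable f →
      Tendsto (fun N : ℕ => ∫ x, Complex.exp ((√N * S.gammaErr n f N x : ℝ) * Complex.I)
        ∂(S.particleLaw N)) atTop (𝓝 (Complex.exp ((-(S.asympVar n f / 2) : ℝ)))) := by
  induction n with
  | zero =>
    intro f hf
    obtain ⟨hm, K, hK⟩ := id hf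
    rw [tendsto_iff_norm_sub_tendsto_zero]
    refine squeeze_zero' (g := fun N : ℕ => 2 * (|1| * (2 * K)) ^ 3 * (√(N : ℝ))⁻¹)
      (Eventually.of_forall fun N => norm_nonneg _) ?_
      (by simpa using tendsto_sqrt_inv_natCast.const_mul (2 * (|1| * (2 * K)) ^ 3))
    have hlarge : ∀ᶠ N : ℕ in atTop, |1| * (2 * K) ≤ √(N : ℝ) :=
      (Real.tendsto_sqrt_atTop.comp tendsto_natCast_atTop_atTop).eventually_ge_atTop _
    filter_upwards [eventually_ne_atTop 0, hlarge] with N hN hNl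
    have key := norm_integral_cexp_empirical_sub_le (μ := S.init) hm hK hN hNl
    have hmeas : Measurable fun y : Fin N → E 0 =>
        Complex.exp ((√N * (1 * (∫ z, f z ∂(empirical y) - ∫ z, f z ∂S.init)) : ℝ) *
          Complex.I) := by
      have := measurable_integral_empirical hm N
      fun_prop
    rw [← S.integral_particleLaw_zero N hmeas.stronglyMeasurable] at key
    have e : ∀ x : Π p, Fin N → E p, S.gammaErr 0 f N x =
        1 * (∫ z, f z ∂(empirical (x 0)) - ∫ z, f z ∂S.init) := fun x => by
      rw [gammaErr, gammaN_eq, weight, gamma_zero, Finset.range_zero, Finset.prod_empty, one_smul,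
        one_mul]
    simp_rw [e, asympVar, eta_zero, gamma_zero, probReal_univ]
    rwa [div_eq_mul_inv _ √(N : ℝ)] at key
  | succ n ih =>
    intro f hf
    set c := ((S.gamma (n + 1)).real Set.univ) ^ 2 *
      (∫ x, f x ^ 2 ∂(S.eta (n + 1)) - (∫ x, f x ∂(S.eta (n + 1))) ^ 2) with hc
    have := h.isProbabilityMeasure_eta (n + 1)
    have hc0 : 0 ≤ c := mul_nonneg (sq_nonneg _) (sub_nonneg.2 (sq_integral_le_integral_sq hf _))
    have hL := h.isBoundedMeasurable_L n hf
    have h1 := (ih _ hL).const_mul (Complex.exp ((-(c / 2) : ℝ)))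
    have e0 : Complex.exp ((-(c / 2) : ℝ)) * Complex.exp ((-(S.asympVar n (S.L n f) / 2) : ℝ)) =
        Complex.exp ((-(S.asympVar (n + 1) f / 2) : ℝ)) := by
      rw [← Complex.exp_add, asympVar, ← hc]
      congr 1
      push_cast
      ring
    rw [e0] at h1
    have hlin := h.tendsto_linErr h2 hconv hrange n hf
    have hsamp := h.tendsto_integral_cexp_sampErr n hf hL.1
    have hvar := h.tendsto_condVar h2 hconv hrange n hf
    refine tendsto_of_tendsto_of_dist h1 ?_
    refine squeeze_zero' (t₀ := atTop)
      (g := fun N : ℕ => √(N : ℝ) * ∫ x, |S.linErr n f N x| ∂(S.particleLaw N) +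
        ‖∫ x, Complex.exp ((√N * S.gammaErr n (S.L n f) N x : ℝ) * Complex.I) *
          (Complex.exp ((√N * S.sampErr n f N x : ℝ) * Complex.I) -
            Complex.exp ((-(S.condVar n f N x / 2) : ℝ))) ∂(S.particleLaw N)‖ +
        ∫ x, |S.condVar n f N x - c| ∂(S.particleLaw N)) (.of_forall fun _ => dist_nonneg) ?_ ?_
    swap
    · have := (hlin.add hsamp.norm).add hvar
      rwa [norm_zero, add_zero, add_zero] at this
    filter_upwards [eventually_ne_atTop 0] with N hN
    set P := S.particleLaw N
    set A : (Π p, Fin N → E p) → ℂ := fun x =>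
      Complex.exp ((√N * S.gammaErr n (S.L n f) N x : ℝ) * Complex.I) with hA
    set B : (Π p, Fin N → E p) → ℂ := fun x =>
      Complex.exp ((√N * S.sampErr n f N x : ℝ) * Complex.I) with hB
    set D : (Π p, Fin N → E p) → ℂ := fun x => Complex.exp ((-(S.condVar n f N x / 2) : ℝ)) with hD
    have m1 : Measurable (S.gammaErr n (S.L n f) N) :=
      (S.measurable_gammaN N n hL.1).sub_const _
    have m2 := S.measurable_sampErr n hf.1 hN
    have m3 := S.measurable_condVar n hf.1 hN
    have m4 := h.measurable_linErr n hf hN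
    have m5 : Measurable (S.gammaErr (n + 1) f N) := (S.measurable_gammaN N _ hf.1).sub_const _
    have mA : Measurable A := by fun_prop
    have mB : Measurable B := by fun_prop
    have mD : Measurable D := by fun_prop
    have nA : ∀ x, ‖A x‖ = 1 := fun x => Complex.norm_exp_ofReal_mul_I _
    have nB : ∀ x, ‖B x‖ = 1 := fun x => Complex.norm_exp_ofReal_mul_I _
    have nD : ∀ x, ‖D x‖ ≤ 1 := fun x => by
      rw [hD, Complex.norm_exp_ofReal, Real.exp_le_one_iff]
      have := S.condVar_nonneg n hf hN x
      linarith
    set F : (Π p, Fin N → E p) → ℂ := fun x =>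
      Complex.exp ((√N * S.gammaErr (n + 1) f N x : ℝ) * Complex.I) with hF
    have mF : Measurable F := by fun_prop
    have nF : ∀ x, ‖F x‖ = 1 := fun x => Complex.norm_exp_ofReal_mul_I _
    have iF : Integrable F P := Integrable.of_bound mF.aestronglyMeasurable 1
      (ae_of_all _ fun x => (nF x).le)
    have iA : Integrable A P := Integrable.of_bound mA.aestronglyMeasurable 1
      (ae_of_all _ fun x => (nA x).le)
    have iAB : Integrable (fun x => A x * B x) P :=
      Integrable.of_bound (mA.mul mB).aestronglyMeasurable 1 (ae_of_all _ fun x => by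
        rw [norm_mul, nA, nB, one_mul])
    have iAD : Integrable (fun x => A x * D x) P :=
      Integrable.of_bound (mA.mul mD).aestronglyMeasurable 1 (ae_of_all _ fun x => by
        rw [norm_mul, nA, one_mul]; exact nD x)
    obtain ⟨_, _, hl⟩ := (h.isRootN_linErr h2 hconv hrange (fun f hf =>
      h.isRootN_etaErr (h.isRootN_gammaErr h2 hconv hrange n) hf) hf).sqrt_mul_integral_abs_le
    have b1 : ‖∫ x, (F x - A x * B x) ∂P‖ ≤ √(N : ℝ) * ∫ x, |S.linErr n f N x| ∂P := by
      rw [← integral_const_mul]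
      refine norm_integral_le_of_norm_le ((hl N hN).1.const_mul _) (ae_of_all _ fun x => ?_)
      have e : A x * B x = Complex.exp ((√N * S.gammaErr n (S.L n f) N x +
          √N * S.sampErr n f N x : ℝ) * Complex.I) := by
        rw [hA, hB, ← Complex.exp_add]; push_cast; ring_nf
      rw [e]
      refine (norm_cexp_mul_I_sub_cexp_mul_I_le _ _).trans (le_of_eq ?_)
      rw [gammaErr, h.gammaN_succ_sub n hf hN, ← gammaErr, ← abs_of_nonneg (Real.sqrt_nonneg (N : ℝ)),
        ← abs_mul, abs_of_nonneg (Real.sqrt_nonneg (N : ℝ))]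
      congr 1
      ring
    have iC : Integrable (fun x => |S.condVar n f N x - c|) P := by
      obtain ⟨K, hK⟩ := hf.2
      obtain ⟨C, hC0, hC⟩ := h.exists_weight_le (n + 1)
      obtain ⟨-, K₂, hK₂⟩ := isBoundedMeasurable_sq hf
      refine Integrable.of_bound (C := C ^ 2 * (K₂ + K ^ 2) + |c|)
        (m3.sub_const c).abs.aestronglyMeasurable (ae_of_all _ fun x => ?_)
      have := S.isProbabilityMeasure_Phi hN (x n)
      rw [Real.norm_eq_abs, abs_abs]
      refine (abs_sub _ _).trans (add_le_add ?_ le_rfl)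
      rw [condVar, abs_mul, abs_pow, abs_of_nonneg (S.weight_nonneg _ _)]
      refine mul_le_mul (pow_le_pow_left₀ (S.weight_nonneg _ _) (hC N hN x) 2)
        ((abs_sub _ _).trans (add_le_add (abs_integral_le_of_abs_le hK₂ _) ?_)) (abs_nonneg _)
        (by positivity)
      rw [abs_pow]
      exact pow_le_pow_left₀ (abs_nonneg _) (abs_integral_le_of_abs_le hK _) 2
    have b3 : ‖∫ x, (A x * D x - Complex.exp ((-(c / 2) : ℝ)) * A x) ∂P‖ ≤
        ∫ x, |S.condVar n f N x - c| ∂P := by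
      refine norm_integral_le_of_norm_le iC (ae_of_all _ fun x => ?_)
      have hcv := S.condVar_nonneg n hf hN x
      rw [mul_comm _ (A x), ← mul_sub, norm_mul, nA, one_mul, hD]
      simp only
      rw [← Complex.ofReal_exp, ← Complex.ofReal_exp, ← Complex.ofReal_sub, Complex.norm_real]
      refine (abs_exp_neg_sub_exp_neg_le (by linarith) (by linarith)).trans ?_
      rw [← sub_div, abs_div, abs_two]
      exact half_le_self (abs_nonneg _)
    -- Telescoping through `A * B` and `A * D`; the middle term is kept as an integral, being small
    -- only after conditioning.
    have e : ∫ x, F x ∂P - Complex.exp ((-(c / 2) : ℝ)) * ∫ x, A x ∂P =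
        ∫ x, (F x - A x * B x) ∂P + ∫ x, A x * (B x - D x) ∂P +
          ∫ x, (A x * D x - Complex.exp ((-(c / 2) : ℝ)) * A x) ∂P := by
      simp_rw [mul_sub]
      rw [integral_sub iF iAB, integral_sub iAB iAD, integral_sub iAD (iA.const_mul _),
        integral_const_mul]
      ring
    rw [dist_comm, dist_eq_norm, e]
    exact (norm_add_le _ _).trans (add_le_add ((norm_add_le _ _).trans
      (add_le_add b1 le_rfl)) b3)

/-! ### Vector-valued functions -/

theorem isBoundedMeasurable_clm_comp {X V : Type*} [MeasurableSpace X] [NormedAddCommGroup V]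
    [NormedSpace ℝ V] [MeasurableSpace V] [BorelSpace V] {φ : X → V} (hφ : IsBoundedMeasurable φ)
    (ℓ : V →L[ℝ] ℝ) : IsBoundedMeasurable fun x => ℓ (φ x) := by
  obtain ⟨hm, C, hC⟩ := hφ
  exact ⟨ℓ.continuous.measurable.comp hm, ‖ℓ‖ * C, fun x => (ℓ.le_opNorm _).trans
    (mul_le_mul_of_nonneg_left (hC x) (norm_nonneg _))⟩

theorem isBoundedMeasurable_of_apply {X ι : Type*} [MeasurableSpace X] [Fintype ι]
    {φ : X → EuclideanSpace ℝ ι} (hφ : ∀ i, IsBoundedMeasurable fun x => φ x i) :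
    IsBoundedMeasurable φ := by
  choose hm C hC using hφ
  refine ⟨?_, ∑ i, C i, fun x => (norm_le_sum_abs_apply _).trans
    (Finset.sum_le_sum fun i _ => hC i x)⟩
  exact (WithLp.measurable_toLp 2 (ι → ℝ)).comp (measurable_pi_lambda _ hm)

section Vector

variable {r : ℕ}

theorem A1.Qop_clm_comp (h : S.A1) (n : ℕ) (ξ : EuclideanSpace ℝ (Fin d))
    {φ : E (n + 1) → EuclideanSpace ℝ (Fin r)} (hφ : IsBoundedMeasurable φ)
    (ℓ : EuclideanSpace ℝ (Fin r) →L[ℝ] ℝ) (x : E n) :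
    S.Qop n ξ (fun y => ℓ (φ y)) x = ℓ (S.Qop n ξ φ x) := by
  have := h.isFiniteKernel_Q n ξ
  exact ℓ.integral_comp_comm (integrable_of_isBoundedMeasurable hφ _)

theorem A1.differentiableAt_Qop (h : S.A1) (h2 : S.A2 Dom) (n : ℕ) (hmem : S.param n ∈ Dom n)
    {φ : E (n + 1) → EuclideanSpace ℝ (Fin r)} (hφ : IsBoundedMeasurable φ) (x : E n) :
    DifferentiableAt ℝ (fun ζ => S.Qop n ζ φ x) (S.param n) := by
  rw [differentiableAt_euclidean]
  intro i
  have e : (fun ζ => S.Qop n ζ φ x i) =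
      fun ζ => S.Qop n ζ (fun y => EuclideanSpace.proj (𝕜 := ℝ) i (φ y)) x := by
    funext ζ
    exact (h.Qop_clm_comp n ζ hφ (EuclideanSpace.proj i) x).symm
  rw [e]
  exact (h2 n _ (isBoundedMeasurable_clm_comp hφ _)).1 x _ hmem

theorem A1.dQ_clm_comp (h : S.A1) (h2 : S.A2 Dom) (n : ℕ) (hmem : S.param n ∈ Dom n)
    {φ : E (n + 1) → EuclideanSpace ℝ (Fin r)} (hφ : IsBoundedMeasurable φ)
    (ℓ : EuclideanSpace ℝ (Fin r) →L[ℝ] ℝ) (x : E n) :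
    S.dQ n (S.param n) (fun y => ℓ (φ y)) x = ℓ ∘L S.dQ n (S.param n) φ x := by
  have e : (fun ζ => S.Qop n ζ (fun y => ℓ (φ y)) x) = ℓ ∘ fun ζ => S.Qop n ζ φ x := by
    funext ζ
    exact h.Qop_clm_comp n ζ hφ ℓ x
  rw [dQ, e]
  exact (ℓ.hasFDerivAt.comp _ (h.differentiableAt_Qop h2 n hmem hφ x).hasFDerivAt).fderiv

theorem A1.integrable_dQ_vector (h : S.A1) (h2 : S.A2 Dom) (n : ℕ) (hmem : S.param n ∈ Dom n)
    {φ : E (n + 1) → EuclideanSpace ℝ (Fin r)} (hφ : IsBoundedMeasurable φ)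
    (μ : Measure (E n)) [IsFiniteMeasure μ] :
    Integrable (fun x => S.dQ n (S.param n) φ x) μ := by
  choose K hK0 hK using fun i : Fin r => h2.exists_norm_dQ_le n hmem
    (isBoundedMeasurable_clm_comp hφ (EuclideanSpace.proj (𝕜 := ℝ) i))
  refine S.integrable_dQ n _ hφ.1 (fun x => h.differentiableAt_Qop h2 n hmem hφ x)
    (C := ∑ i, K i) (fun x => ?_) μ
  refine ContinuousLinearMap.opNorm_le_bound _ (Finset.sum_nonneg fun i _ => hK0 i) fun v => ?_
  refine (norm_le_sum_abs_apply _).trans ?_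
  rw [Finset.sum_mul]
  refine Finset.sum_le_sum fun i _ => ?_
  have := (ContinuousLinearMap.le_opNorm (S.dQ n (S.param n)
    (fun y => EuclideanSpace.proj (𝕜 := ℝ) i (φ y)) x) v).trans
      (mul_le_mul_of_nonneg_right (hK i x) (norm_nonneg _))
  rw [h.dQ_clm_comp h2 n hmem hφ] at this
  exact this

/-- The assumptions bear on scalar test functions. Differentiability and integrability of the vector
derivative are rebuilt from coordinates, so that `ℓ` passes through both the derivative and the
Bochner integral. -/
theorem A1.L_clm_comp (h : S.A1) (h2 : S.A2 Dom) (n : ℕ) (hmem : S.param n ∈ Dom n)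
    {φ : E (n + 1) → EuclideanSpace ℝ (Fin r)} (hφ : IsBoundedMeasurable φ)
    (ℓ : EuclideanSpace ℝ (Fin r) →L[ℝ] ℝ) :
    S.L n (fun y => ℓ (φ y)) = fun x => ℓ (S.L n φ x) := by
  have := h.isProbabilityMeasure_eta n
  funext x
  rw [L, L, map_add, h.Qop_clm_comp n _ hφ]
  simp_rw [h.dQ_clm_comp h2 n hmem hφ]
  have := (ContinuousLinearMap.compL ℝ (EuclideanSpace ℝ (Fin d)) (EuclideanSpace ℝ (Fin r)) ℝ
    ℓ).integral_comp_comm (h.integrable_dQ_vector h2 n hmem hφ (S.eta n))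
  simp only [ContinuousLinearMap.compL_apply] at this
  rw [this]
  rfl

theorem A1.isBoundedMeasurable_L_vector (h : S.A1) (h2 : S.A2 Dom) (n : ℕ)
    (hmem : S.param n ∈ Dom n) {φ : E (n + 1) → EuclideanSpace ℝ (Fin r)}
    (hφ : IsBoundedMeasurable φ) : IsBoundedMeasurable (S.L n φ) := by
  refine isBoundedMeasurable_of_apply fun i => ?_
  have := h.isBoundedMeasurable_L n
    (isBoundedMeasurable_clm_comp hφ (EuclideanSpace.proj (𝕜 := ℝ) i))
  rwa [h.L_clm_comp h2 n hmem hφ] at this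

/-- The two claims descend together, as commuting `ℓ` with the next `L` requires boundedness of the
function reached so far. -/
theorem A1.Lsemi_clm_comp (h : S.A1) (h2 : S.A2 Dom) (hmem : ∀ n, S.param n ∈ Dom n) {p n : ℕ}
    (hpn : p ≤ n) {φ : E n → EuclideanSpace ℝ (Fin r)} (hφ : IsBoundedMeasurable φ) :
    IsBoundedMeasurable (S.Lsemi hpn φ) ∧ ∀ ℓ : EuclideanSpace ℝ (Fin r) →L[ℝ] ℝ,
      S.Lsemi hpn (fun y => ℓ (φ y)) = fun x => ℓ (S.Lsemi hpn φ x) := by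
  induction hpn using Nat.decreasingInduction with
  | self => simp_rw [Lsemi_self]; exact ⟨hφ, fun _ => trivial⟩
  | of_succ k hk ih =>
    simp_rw [S.Lsemi_step hk]
    refine ⟨h.isBoundedMeasurable_L_vector h2 k (hmem k) ih.1, fun ℓ => ?_⟩
    rw [ih.2 ℓ, h.L_clm_comp h2 k (hmem k) ih.1]

/-- `Lsemi_step` peels off the operator at the initial time; the recursion of `asympVar` needs the
one at the final time. -/
theorem Lsemi_succ (S : AdaptiveSMC E d) {V : Type*} [NormedAddCommGroup V] [NormedSpace ℝ V]
    {p n : ℕ} (hpn : p ≤ n) (φ : E (n + 1) → V) :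
    S.Lsemi (hpn.trans n.le_succ) φ = S.Lsemi hpn (S.L n φ) :=
  Nat.decreasingInduction_succ _ _ hpn (hpn.trans n.le_succ)

theorem asympVar_eq_sum (S : AdaptiveSMC E d) (n : ℕ) (f : E n → ℝ) :
    S.asympVar n f = ∑ p : Fin (n + 1), ((S.gamma p).real Set.univ) ^ 2 *
      (∫ x, S.Lsemi p.is_le f x ^ 2 ∂(S.eta p) - (∫ x, S.Lsemi p.is_le f x ∂(S.eta p)) ^ 2) := by
  induction n with
  | zero =>
    rw [Fin.sum_univ_one, asympVar]
    have : S.Lsemi (Fin.is_le (0 : Fin 1)) f = f := S.Lsemi_self 0 f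
    rw [this]
    rfl
  | succ n ih =>
    rw [Fin.sum_univ_castSucc, asympVar, ih, add_comm]
    congr 1
    · refine Finset.sum_congr rfl fun p _ => ?_
      have : S.Lsemi p.castSucc.is_le f = S.Lsemi p.is_le (S.L n f) := S.Lsemi_succ p.is_le f
      rw [this]
      rfl
    · have : S.Lsemi (Fin.last (n + 1)).is_le f = f := S.Lsemi_self (n + 1) f
      rw [this]
      rfl

end Vector

/-! ### The covariance matrix -/

/-- The quadratic form of a covariance matrix at `t` is the variance of the projection along `t`.
This links the matrix to the scalar limit theorem. -/
theorem dotProduct_covMat_mulVec {X : Type*} [MeasurableSpace X] {r : ℕ} (μ : Measure X)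
    [IsProbabilityMeasure μ] {φ : X → EuclideanSpace ℝ (Fin r)} (hφ : IsBoundedMeasurable φ)
    (t : EuclideanSpace ℝ (Fin r)) :
    t.ofLp ⬝ᵥ (covMat μ φ).mulVec t.ofLp =
      ∫ x, innerSL ℝ t (φ x) ^ 2 ∂μ - (∫ x, innerSL ℝ t (φ x) ∂μ) ^ 2 := by
  set ℓ := innerSL ℝ t with hℓ
  set m := ∫ y, φ y ∂μ with hm
  have hφi := integrable_of_isBoundedMeasurable hφ μ
  have hℓφ := isBoundedMeasurable_clm_comp hφ ℓ
  have hi := integrable_of_isBoundedMeasurable hℓφ μ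
  have hi2 := integrable_of_isBoundedMeasurable (isBoundedMeasurable_sq hℓφ) μ
  have hψ : IsBoundedMeasurable fun x => φ x - m := by
    obtain ⟨h1, C, hC⟩ := hφ
    exact ⟨h1.sub_const m, C + ‖m‖, fun x => (norm_sub_le _ _).trans (add_le_add (hC x) le_rfl)⟩
  have hψi : ∀ i j, Integrable (fun x => (φ x - m) i * (φ x - m) j) μ := fun i j => by
    obtain ⟨h1, C, hC⟩ := hψ
    refine Integrable.of_bound (C := C * C) (Measurable.aestronglyMeasurable ?_)
      (ae_of_all _ fun x => ?_)
    · exact ((EuclideanSpace.proj (𝕜 := ℝ) i).continuous.measurable.comp h1).mul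
        ((EuclideanSpace.proj (𝕜 := ℝ) j).continuous.measurable.comp h1)
    · rw [norm_mul]
      exact mul_le_mul ((PiLp.norm_apply_le _ _).trans (hC x))
        ((PiLp.norm_apply_le _ _).trans (hC x)) (norm_nonneg _) ((norm_nonneg _).trans (hC x))
  have hℓsum : ∀ v : EuclideanSpace ℝ (Fin r), ℓ v = ∑ i, t i * v i := fun v => by
    rw [hℓ, innerSL_apply_apply, PiLp.inner_apply]
    exact Finset.sum_congr rfl fun i _ => by simp [mul_comm]
  have e1 : t.ofLp ⬝ᵥ (covMat μ φ).mulVec t.ofLp = ∫ x, ℓ (φ x - m) ^ 2 ∂μ := by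
    simp_rw [hℓsum, sq, Finset.sum_mul_sum]
    rw [integral_finsetSum _ fun i _ => integrable_finsetSum _ fun j _ => by
      refine ((hψi i j).const_mul (t i * t j)).congr (ae_of_all _ fun x => ?_)
      simp only
      ring]
    rw [dotProduct]
    refine Finset.sum_congr rfl fun i _ => ?_
    rw [integral_finsetSum _ fun j _ => by
      refine ((hψi i j).const_mul (t i * t j)).congr (ae_of_all _ fun x => ?_)
      simp only
      ring]
    rw [Matrix.mulVec, dotProduct, Finset.mul_sum]
    refine Finset.sum_congr rfl fun j _ => ?_
    rw [covMat, Matrix.of_apply, ← hm, mul_comm (∫ x, _ ∂μ), ← mul_assoc, ← integral_const_mul]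
    refine integral_congr_ae (ae_of_all _ fun x => ?_)
    simp only
    ring
  have e2 : ∫ x, ℓ (φ x) ∂μ = ℓ m := ℓ.integral_comp_comm hφi
  have e3 : ∀ x, ℓ (φ x - m) ^ 2 = ℓ (φ x) ^ 2 - (2 * ℓ m * ℓ (φ x) - ℓ m ^ 2) := fun x => by
    rw [map_sub]; ring
  have h3 : Integrable (fun x => 2 * ℓ m * ℓ (φ x) - ℓ m ^ 2) μ :=
    (hi.const_mul _).sub (integrable_const _)
  rw [e1]
  simp_rw [e3]
  rw [integral_sub hi2 h3, integral_sub (hi.const_mul _) (integrable_const _),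
    integral_const_mul, e2]
  simp only [integral_const, probReal_univ, one_smul]
  ring

theorem A1.dotProduct_asympCov_mulVec (h : S.A1) (h2 : S.A2 Dom)
    (hmem : ∀ n, S.param n ∈ Dom n) {n r : ℕ} {φ : E n → EuclideanSpace ℝ (Fin r)}
    (hφ : IsBoundedMeasurable φ) (t : EuclideanSpace ℝ (Fin r)) :
    t.ofLp ⬝ᵥ (S.asympCov n φ).mulVec t.ofLp = S.asympVar n fun y => innerSL ℝ t (φ y) := by
  rw [asympVar_eq_sum, asympCov, Matrix.sum_mulVec, dotProduct_sum]
  refine Finset.sum_congr rfl fun p _ => ?_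
  have := h.isProbabilityMeasure_eta p
  obtain ⟨hb, hℓ⟩ := h.Lsemi_clm_comp h2 hmem p.is_le hφ
  rw [Matrix.smul_mulVec, dotProduct_smul, dotProduct_covMat_mulVec _ hb, hℓ, smul_eq_mul]

/-- Each term of the quadratic form is a squared mass times a variance. Positivity is also needed to
use the characteristic function of `multivariateGaussian`. -/
theorem A1.posSemidef_asympCov (h : S.A1) (h2 : S.A2 Dom)
    (hmem : ∀ n, S.param n ∈ Dom n) {n r : ℕ} {φ : E n → EuclideanSpace ℝ (Fin r)}
    (hφ : IsBoundedMeasurable φ) : (S.asympCov n φ).PosSemidef := by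
  refine Matrix.PosSemidef.of_dotProduct_mulVec_nonneg ?_ fun t => ?_
  · refine Matrix.IsHermitian.ext fun i j => ?_
    simp only [asympCov, Matrix.sum_apply, Matrix.smul_apply, covMat, Matrix.of_apply, star_trivial]
    refine Finset.sum_congr rfl fun p _ => ?_
    simp_rw [mul_comm]
  · have := h.dotProduct_asympCov_mulVec h2 hmem hφ (WithLp.toLp 2 t)
    rw [star_trivial]
    refine this.symm ▸ ?_
    rw [asympVar_eq_sum]
    refine Finset.sum_nonneg fun p _ => mul_nonneg (sq_nonneg _) (sub_nonneg.2 ?_)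
    have := h.isProbabilityMeasure_eta p
    obtain ⟨hb, hℓ⟩ := h.Lsemi_clm_comp h2 hmem p.is_le hφ
    rw [hℓ]
    exact sq_integral_le_integral_sq (isBoundedMeasurable_clm_comp hb _) _

theorem measurable_gammaN_vector (S : AdaptiveSMC E d) (N n : ℕ) {r : ℕ}
    {φ : E n → EuclideanSpace ℝ (Fin r)} (hφ : Measurable φ) :
    Measurable fun x : Π p, Fin N → E p => S.gammaN n φ x := by
  simp_rw [gammaN_eq]
  refine (S.measurable_weight N n).smul ?_
  simp_rw [fun x : Π p, Fin N → E p => integral_empirical (x n) hφ.stronglyMeasurable]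
  fun_prop

end AdaptiveSMC

/-! ### The central limit theorem. -/

theorem mainTheorem1 {E : ℕ → Type*} [∀ n, MeasurableSpace (E n)]
    [∀ n, MeasurableSpace.CountablyGenerated (E n)] {d : ℕ} (S : AdaptiveSMC E d)
    (Dom : ℕ → Set (EuclideanSpace ℝ (Fin d)))
    (hDom_convex : ∀ n, Convex ℝ (Dom n))
    (hDom_range : ∀ n, Set.range (S.stat n) ⊆ Dom n)
    (hA1 : S.A1) (hA2 : S.A2 Dom)
    (n r : ℕ) (φ : E n → EuclideanSpace ℝ (Fin r)) (hφ : IsBoundedMeasurable φ) :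
    (S.asympCov n φ).PosSemidef ∧
    TendstoInDistribution
      (fun (N : ℕ) (x : Π p, Fin N → E p) =>
        √(N : ℝ) • (S.gammaN n φ x - ∫ z, φ z ∂(S.gamma n)))
      atTop
      (fun y : EuclideanSpace ℝ (Fin r) => y)
      (fun N => S.particleLaw N)
      (multivariateGaussian 0 (S.asympCov n φ)) := by
  have hmem := fun n => hA1.param_mem hDom_convex hDom_range n
  have hpos := hA1.posSemidef_asympCov hA2 hmem hφ
  have hmeas : ∀ N : ℕ, Measurable fun x : Π p, Fin N → E p =>
      √(N : ℝ) • (S.gammaN n φ x - ∫ z, φ z ∂(S.gamma n)) := fun N => by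
    have := S.measurable_gammaN_vector N n hφ.1
    fun_prop
  refine ⟨hpos, ⟨fun N => (hmeas N).aemeasurable, aemeasurable_id, ?_⟩⟩
  refine ProbabilityMeasure.tendsto_iff_tendsto_charFun.2 fun t => ?_
  have hfin := hA1.isFiniteMeasure_gamma n
  -- The frequency `t` is absorbed into the scalar test function `⟨t, φ⟩`, so the scalar result at
  -- frequency one gives every `t`.
  have key := hA1.tendsto_integral_cexp_gammaErr hA2 hDom_convex hDom_range n _
    (AdaptiveSMC.isBoundedMeasurable_clm_comp hφ (innerSL ℝ t))
  have e1 : charFun ((multivariateGaussian 0 (S.asympCov n φ)).map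
      fun y : EuclideanSpace ℝ (Fin r) => y) t =
      Complex.exp ((-(S.asympVar n (fun y => innerSL ℝ t (φ y)) / 2) : ℝ)) := by
    rw [Measure.map_id', charFun_multivariateGaussian hpos,
      ← hA1.dotProduct_asympCov_mulVec hA2 hmem hφ]
    simp
  change Tendsto (fun N => charFun ((S.particleLaw N).map fun x : Π p, Fin N → E p =>
    √(N : ℝ) • (S.gammaN n φ x - ∫ z, φ z ∂(S.gamma n))) t) atTop
    (𝓝 (charFun ((multivariateGaussian 0 (S.asympCov n φ)).map
      fun y : EuclideanSpace ℝ (Fin r) => y) t))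
  rw [e1]
  refine key.congr' ?_
  filter_upwards [eventually_ne_atTop 0] with N hN
  rw [charFun_apply, integral_map (hmeas N).aemeasurable (by fun_prop)]
  refine integral_congr_ae (ae_of_all _ fun x => ?_)
  have := isProbabilityMeasure_empirical hN (x n)
  have e2 : innerSL ℝ t (√(N : ℝ) • (S.gammaN n φ x - ∫ z, φ z ∂(S.gamma n))) =
      √N * S.gammaErr n (fun y => innerSL ℝ t (φ y)) N x := by
    rw [map_smul, map_sub, AdaptiveSMC.gammaErr, AdaptiveSMC.gammaN_eq, AdaptiveSMC.gammaN_eq, map_smul,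
      ContinuousLinearMap.integral_comp_comm _ (integrable_of_isBoundedMeasurable hφ _),
      ContinuousLinearMap.integral_comp_comm _ (integrable_of_isBoundedMeasurable hφ _),
      smul_eq_mul]
  simp only
  rw [← e2, innerSL_apply_apply, real_inner_comm]
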